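/- Let $\lambda_1,\lambda_2,\mu_1,\mu_2,c_1,c_2>0$ satisfy $\lambda_1>\mu_1c_1$ and $\mu_1c_1+\mu_2c_2<\lambda_1+\lambda_2$. Put $S=\lambda_1+\lambda_2+\mu_1c_1+\mu_2c_2$, $$K(x,y)=\mu_1c_1x^2y+\mu_2c_2xy^2-Sxy+\lambda_1y+\lambda_2x,$$ $$\Delta_1(y)=(\mu_2c_2y^2-Sy+\lambda_2)^2-4\mu_1c_1\lambda_1y^2,$$ and let $0<y_1<y_2<1<y_3<y_4$ be the zeros of $\Delta_1$. Let $\sigma_1$ be the analytic function on $\mathbb C\setminus([y_1,y_2]\cup[y_3,y_4])$ equal to $\sqrt{\Delta_1}$ near $0$, and let $$X_0(y)=\frac{-(\mu_2c_2y^2-Sy+\lambda_2)+\sigma_1(y)}{2\mu_1c_1y},\qquad X_0(0)=0,$$ be the root of $K(\cdot,y)$ vanishing at the origin; for $y\in[y_1,y_2]$ write $X_0(y+0i)=\lim_{\varepsilon\downarrow0}X_0(y+i\varepsilon)$. Let $Y_0(x)$ be the root of $K(x,\cdot)$ vanishing at the origin, defined in the same way after exchanging the indices $1$ and $2$. Let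 $r_1=\sqrt{\lambda_1/(\mu_1c_1)}$, $D_{r_1}=\{|x|<r_1\}$, $C_{r_1}=\{|x|=r_1\}$, and $$\alpha_1(x)=\frac{\bar x\,(Y_0(x)-x)}{x\,(Y_0(x)-\bar x)}\quad(x\in C_{r_1}),\qquad \Theta_1(y)=\arctan\frac{\sqrt{-\Delta_1(y)}}{\mu_2c_2y^2-Sy+2\lambda_1+\lambda_2}\quad(y\in[y_1,y_2]).$$ Consider the homogeneous Riemann–Hilbert problem: find $\phi$ analytic in $D_{r_1}$ and in $\mathbb C\setminus\overline{D_{r_1}}$, having interior and exterior limits $\phi^i,\phi^e$ at every point of $C_{r_1}$ with $\phi^i=\alpha_1\phi^e$ on $C_{r_1}$, and $\phi(x)\to1$ as $|x|\to\infty$. Let $$\phi_1(x)=\exp\left(\frac{x}{\pi}\int_{y_1}^{y_2}\frac{(\lambda_2-\mu_2c_2y^2)\,\Theta_1(y)}{y\,K(x,y)}\,dy\right),\qquad x\notin C_{r_1}.$$ Then $\phi_1$ is a solution of this Riemann–Hilbert problem, and every solution coincides with $\phi_1$ in $D_{r_1}$. Moreover, for every $y\in[y_1,y_2]$ the limit $x=X_0(y+0i)$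 exists and lies on $C_{r_1}$, the Cauchy principal value $$\Phi_1(y)=\frac1\pi\,\mathrm{p.v.}\!\int_{y_1}^{y_2}\frac{y(\lambda_2-\mu_2c_2\xi^2)\,\Theta_1(\xi)}{\xi(\mu_2c_2y\xi-\lambda_2)}\,\frac{d\xi}{\xi-y}=\frac1\pi\lim_{\varepsilon\downarrow0}\int_{[y_1,y_2]\setminus(y-\varepsilon,y+\varepsilon)}\frac{y(\lambda_2-\mu_2c_2\xi^2)\,\Theta_1(\xi)}{\xi(\mu_2c_2y\xi-\lambda_2)(\xi-y)}\,d\xi$$ exists as a finite real number, and the interior limit of $\phi_1$ at $x$ exists and is $$\phi_1^i(x)=\lim_{z\to x,\ z\in D_{r_1}}\phi_1(z)=\exp\bigl(-i\,\Theta_1(y)+\Phi_1(y)\bigr).$$ -/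

import Mathlib

open Set Filter Topology

/-- Rates of the limiting random walk: arrival rates `lam₁, lam₂`, service rates `mu₁, mu₂`
and rescaled capacities `c₁, c₂`. -/
structure RWParams where
  lam₁ : ℝ
  lam₂ : ℝ
  mu₁ : ℝ
  mu₂ : ℝ
  c₁ : ℝ
  c₂ : ℝ

namespace RWParams

/-- All rates are positive. -/
structure Pos (p : RWParams) : Prop where
  lam₁ : 0 < p.lam₁
  lam₂ : 0 < p.lam₂
  mu₁ : 0 < p.mu₁
  mu₂ : 0 < p.mu₂
  c₁ : 0 < p.c₁
  c₂ : 0 < p.c₂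

/-- The walk is ergodic: `λ₁ > μ₁ c₁` and `μ₁ c₁ + μ₂ c₂ < λ₁ + λ₂`. -/
structure Stable (p : RWParams) : Prop where
  first : p.mu₁ * p.c₁ < p.lam₁
  total : p.mu₁ * p.c₁ + p.mu₂ * p.c₂ < p.lam₁ + p.lam₂

/-- Exchange of the roles of the two coordinates (hence of `x` and `y`). -/
def swap (p : RWParams) : RWParams := ⟨p.lam₂, p.lam₁, p.mu₂, p.mu₁, p.c₂, p.c₁⟩

/-- `μ₁ c₁`. -/
def m₁ (p : RWParams) : ℝ := p.mu₁ * p.c₁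

/-- `μ₂ c₂`. -/
def m₂ (p : RWParams) : ℝ := p.mu₂ * p.c₂

/-- `λ₁ + λ₂ + μ₁ c₁ + μ₂ c₂`. -/
def S (p : RWParams) : ℝ := p.lam₁ + p.lam₂ + p.m₁ + p.m₂

/-- The kernel
`K(x,y) = μ₁c₁ x² y + μ₂c₂ x y² - (λ₁ + λ₂ + μ₁c₁ + μ₂c₂) x y + λ₁ y + λ₂ x`. -/
def K (p : RWParams) (x y : ℂ) : ℂ :=
  p.m₁ * x ^ 2 * y + p.m₂ * x * y ^ 2 - p.S * x * y + p.lam₁ * y + p.lam₂ * x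

/-- `μ₂c₂ y² - (λ₁ + λ₂ + μ₁c₁ + μ₂c₂) y + λ₂` at a complex point. -/
def B (p : RWParams) (y : ℂ) : ℂ := p.m₂ * y ^ 2 - p.S * y + p.lam₂

/-- The same polynomial at a real point. -/
def Breal (p : RWParams) (y : ℝ) : ℝ := p.m₂ * y ^ 2 - p.S * y + p.lam₂

/-- The discriminant `Δ₁` of `K(·, y)`, at a complex point. -/
def Delta₁ (p : RWParams) (y : ℂ) : ℂ := p.B y ^ 2 - 4 * p.m₁ * p.lam₁ * y ^ 2

/-- The discriminant `Δ₁` at a real point. -/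
def Delta₁real (p : RWParams) (y : ℝ) : ℝ := p.Breal y ^ 2 - 4 * p.m₁ * p.lam₁ * y ^ 2

theorem B_ofReal (p : RWParams) (y : ℝ) : p.B y = p.Breal y := by
  simp [B, Breal]

theorem Delta₁_ofReal (p : RWParams) (y : ℝ) : p.Delta₁ y = p.Delta₁real y := by
  simp [Delta₁, Delta₁real, B_ofReal]

/-- `S - 2 √(μ₁ c₁ λ₁)` -/
noncomputable def Tminus (p : RWParams) : ℝ := p.S - 2 * √(p.m₁ * p.lam₁)

/-- `S + 2 √(μ₁ c₁ λ₁)` -/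
noncomputable def Tplus (p : RWParams) : ℝ := p.S + 2 * √(p.m₁ * p.lam₁)

/-! The four branch points `y₁ < y₂ < y₃ < y₄`, the zeros of `Δ₁`
(see `Delta₁real_eq`, `branch_order` and `branch_one`). The discriminant is the product of the
quadratics `m₂ y² - T y + λ₂` with `T = Tminus` and `T = Tplus`. -/

noncomputable def y₁ (p : RWParams) : ℝ :=
  (p.Tplus - √(p.Tplus ^ 2 - 4 * p.m₂ * p.lam₂)) / (2 * p.m₂)

noncomputable def y₂ (p : RWParams) : ℝ :=
  (p.Tminus - √(p.Tminus ^ 2 - 4 * p.m₂ * p.lam₂)) / (2 * p.m₂)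

noncomputable def y₃ (p : RWParams) : ℝ :=
  (p.Tminus + √(p.Tminus ^ 2 - 4 * p.m₂ * p.lam₂)) / (2 * p.m₂)

noncomputable def y₄ (p : RWParams) : ℝ :=
  (p.Tplus + √(p.Tplus ^ 2 - 4 * p.m₂ * p.lam₂)) / (2 * p.m₂)

/-- The cuts `[y₁, y₂] ∪ [y₃, y₄]`, as a subset of `ℂ`. -/
def cuts (p : RWParams) : Set ℂ := (fun t : ℝ => (t : ℂ)) '' (Icc p.y₁ p.y₂ ∪ Icc p.y₃ p.y₄)

/-- `σ₁`: the analytic function on `ℂ ∖ cuts` which equals `√Δ₁` near `0`. Off the cuts,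
`Δ₁ / B²` avoids the nonpositive reals, so that `B √(Δ₁ / B²)`, with the principal square root,
is this function: see `sigma₁_analytic` and `sigma₁_near_zero`. -/
noncomputable def sigma₁ (p : RWParams) (y : ℂ) : ℂ :=
  p.B y * (p.Delta₁ y / p.B y ^ 2) ^ (1 / 2 : ℂ)

/-- `X₀(y)`: the root of `K(·, y)` that vanishes at the origin. -/
noncomputable def X₀ (p : RWParams) (y : ℂ) : ℂ := (-p.B y + p.sigma₁ y) / (2 * p.m₁ * y)

/-- `Y₀(x)`: the root of `K(x, ·)` that vanishes at the origin. -/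
noncomputable def Y₀ (p : RWParams) (x : ℂ) : ℂ := p.swap.X₀ x

/-- The radius `r₁ = √(λ₁ / (μ₁ c₁))`. -/
noncomputable def r₁ (p : RWParams) : ℝ := √(p.lam₁ / p.m₁)

/-- The open disk `D_{r₁}`. -/
def Dint (p : RWParams) : Set ℂ := Metric.ball 0 p.r₁

/-- The exterior `ℂ ∖ closure D_{r₁}` of the circle `C_{r₁}`. -/
def Dext (p : RWParams) : Set ℂ := (Metric.closedBall 0 p.r₁)ᶜ

/-- The coefficient `α₁(x) = x̄ (Y₀(x) - x) / (x (Y₀(x) - x̄))` on the circle `C_{r₁}`. -/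
noncomputable def alpha₁ (p : RWParams) (x : ℂ) : ℂ :=
  (starRingEnd ℂ) x * (p.Y₀ x - x) / (x * (p.Y₀ x - (starRingEnd ℂ) x))

/-- `φ` solves the homogeneous Riemann–Hilbert problem on `C_{r₁}` with coefficient `α₁`: it is
sectionally analytic, its interior and exterior limits satisfy `φⁱ = α₁ φᵉ`, and it is normalized
by the value `1` at infinity. -/
structure IsRHSolution (p : RWParams) (φ : ℂ → ℂ) : Prop where
  analytic_int : AnalyticOnNhd ℂ φ p.Dint
  analytic_ext : AnalyticOnNhd ℂ φ p.Dext
  jump : ∀ x ∈ Metric.sphere (0 : ℂ) p.r₁, ∃ φi φe : ℂ,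
    Tendsto φ (𝓝[p.Dint] x) (𝓝 φi) ∧ Tendsto φ (𝓝[p.Dext] x) (𝓝 φe) ∧ φi = p.alpha₁ x * φe
  at_infinity : Tendsto φ (Bornology.cobounded ℂ) (𝓝 1)

/-- `Θ₁(y) = arctan (√(-Δ₁(y)) / (μ₂c₂ y² - (λ₁ + λ₂ + μ₁c₁ + μ₂c₂) y + 2λ₁ + λ₂))`. -/
noncomputable def Theta₁ (p : RWParams) (y : ℝ) : ℝ :=
  Real.arctan (√(-p.Delta₁real y) / (p.m₂ * y ^ 2 - p.S * y + 2 * p.lam₁ + p.lam₂))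

/-- `φ₁(x) = exp ((x/π) ∫_{y₁}^{y₂} (λ₂ - μ₂c₂ y²) Θ₁(y) / (y K(x,y)) dy)`. -/
noncomputable def phi₁ (p : RWParams) (x : ℂ) : ℂ :=
  Complex.exp (x / Real.pi *
    ∫ y in p.y₁..p.y₂, ((p.lam₂ - p.m₂ * y ^ 2) * p.Theta₁ y : ℝ) / (y * p.K x y))

/-- `I` is the Cauchy principal value at `y` of `∫_a^b f`: the limit, as `ε ↓ 0`, of the integrals
over `[a,b] ∖ (y-ε, y+ε)`, all of which converge absolutely. -/
def HasCauchyPV (f : ℝ → ℝ) (a b y I : ℝ) : Prop :=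
  (∀ ε > 0, MeasureTheory.IntegrableOn f (Icc a b \ Ioo (y - ε) (y + ε))) ∧
  Tendsto (fun ε : ℝ => ∫ ξ in Icc a b \ Ioo (y - ε) (y + ε), f ξ) (𝓝[>] 0) (𝓝 I)

/-- The integrand of `π Φ₁(y)`, as a function of `ξ`. -/
noncomputable def PhiIntegrand (p : RWParams) (y ξ : ℝ) : ℝ :=
  y * (p.lam₂ - p.m₂ * ξ ^ 2) * p.Theta₁ ξ / (ξ * (p.m₂ * y * ξ - p.lam₂)) / (ξ - y)

/-! ### The branch points and the square root -/

theorem Pos.m₁ {p : RWParams} (h : p.Pos) : 0 < p.m₁ := mul_pos h.mu₁ h.c₁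

theorem Pos.m₂ {p : RWParams} (h : p.Pos) : 0 < p.m₂ := mul_pos h.mu₂ h.c₂

theorem Pos.swap {p : RWParams} (h : p.Pos) : p.swap.Pos :=
  ⟨h.lam₂, h.lam₁, h.mu₂, h.mu₁, h.c₂, h.c₁⟩

theorem K_swap (p : RWParams) (x y : ℂ) : p.swap.K y x = p.K x y := by
  simp only [K, S, RWParams.m₁, RWParams.m₂, RWParams.swap]
  push_cast
  ring

theorem two_sqrt_le {a b : ℝ} (ha : 0 < a) (hb : 0 < b) : 2 * √(a * b) ≤ a + b := by
  have h := Real.sq_sqrt (mul_pos ha hb).le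
  nlinarith [sq_nonneg (a - b), Real.sqrt_nonneg (a * b)]

theorem two_sqrt_lt {a b : ℝ} (ha : 0 < a) (hb : 0 < b) (hab : a ≠ b) :
    2 * √(a * b) < a + b := by
  have h := Real.sq_sqrt (mul_pos ha hb).le
  have h2 : 0 < (a - b) ^ 2 := by have := sub_ne_zero.2 hab; positivity
  nlinarith [Real.sqrt_nonneg (a * b)]

theorem Tminus_gt {p : RWParams} (h : p.Pos) (hne : p.m₁ ≠ p.lam₁ ∨ p.m₂ ≠ p.lam₂) :
    2 * √(p.m₂ * p.lam₂) < p.Tminus := by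
  have a1 := two_sqrt_le h.m₁ h.lam₁
  have a2 := two_sqrt_le h.m₂ h.lam₂
  unfold Tminus S
  rcases hne with hne | hne
  · have := two_sqrt_lt h.m₁ h.lam₁ hne
    linarith
  · have := two_sqrt_lt h.m₂ h.lam₂ hne
    linarith

theorem disc_pos {p : RWParams} (h : p.Pos) (hne : p.m₁ ≠ p.lam₁ ∨ p.m₂ ≠ p.lam₂) {T : ℝ}
    (hT : p.Tminus ≤ T) : 0 < T ^ 2 - 4 * p.m₂ * p.lam₂ := by
  have a1 := Tminus_gt h hne
  have a2 := Real.sq_sqrt (mul_pos h.m₂ h.lam₂).le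
  have a3 := Real.sqrt_nonneg (p.m₂ * p.lam₂)
  nlinarith

theorem Tminus_lt_Tplus {p : RWParams} (h : p.Pos) : p.Tminus < p.Tplus := by
  have := Real.sqrt_pos.2 (mul_pos h.m₁ h.lam₁)
  unfold Tminus Tplus
  linarith

theorem quad_minus {p : RWParams} (h : p.Pos) (hne : p.m₁ ≠ p.lam₁ ∨ p.m₂ ≠ p.lam₂) (y : ℝ) :
    p.m₂ * y ^ 2 - p.Tminus * y + p.lam₂ = p.m₂ * ((y - p.y₂) * (y - p.y₃)) := by
  have hd := Real.sq_sqrt (disc_pos h hne le_rfl).le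
  have hm := h.m₂.ne'
  unfold y₂ y₃
  field_simp
  ring_nf at hd ⊢
  rw [hd]
  ring

theorem quad_plus {p : RWParams} (h : p.Pos) (hne : p.m₁ ≠ p.lam₁ ∨ p.m₂ ≠ p.lam₂) (y : ℝ) :
    p.m₂ * y ^ 2 - p.Tplus * y + p.lam₂ = p.m₂ * ((y - p.y₁) * (y - p.y₄)) := by
  have hd := Real.sq_sqrt (disc_pos h hne (Tminus_lt_Tplus h).le).le
  have hm := h.m₂.ne'
  unfold y₁ y₄
  field_simp
  ring_nf at hd ⊢
  rw [hd]
  ring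

theorem Delta₁real_eq {p : RWParams} (h : p.Pos) (hne : p.m₁ ≠ p.lam₁ ∨ p.m₂ ≠ p.lam₂) (y : ℝ) :
    p.Delta₁real y =
      p.m₂ ^ 2 * ((y - p.y₁) * (y - p.y₂) * (y - p.y₃) * (y - p.y₄)) := by
  have h1 := quad_minus h hne y
  have h2 := quad_plus h hne y
  have h3 := Real.sq_sqrt (mul_pos h.m₁ h.lam₁).le
  have h4 : p.Delta₁real y = (p.m₂ * y ^ 2 - p.Tminus * y + p.lam₂) *
      (p.m₂ * y ^ 2 - p.Tplus * y + p.lam₂) := by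
    unfold Delta₁real Breal Tminus Tplus
    linear_combination 4 * y ^ 2 * h3
  rw [h4, h1, h2]
  ring

theorem branch_order {p : RWParams} (h : p.Pos) (hne : p.m₁ ≠ p.lam₁ ∨ p.m₂ ≠ p.lam₂) :
    0 < p.y₁ ∧ p.y₁ < p.y₂ ∧ p.y₂ < p.y₃ ∧ p.y₃ < p.y₄ := by
  have hm := h.m₂
  have hl := h.lam₂
  have hT : 0 < p.Tminus := by
    have := Tminus_gt h hne
    have := Real.sqrt_nonneg (p.m₂ * p.lam₂)
    linarith
  have hT2 := Tminus_lt_Tplus h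
  have h23 : p.y₂ < p.y₃ := by
    have := Real.sqrt_pos.2 (disc_pos h hne le_rfl)
    unfold y₂ y₃
    gcongr
    linarith
  have h14 : p.y₁ < p.y₄ := by
    have := Real.sqrt_pos.2 (disc_pos h hne hT2.le)
    unfold y₁ y₄
    gcongr
    linarith
  have p1 : 0 < p.y₁ := by
    unfold y₁
    apply div_pos _ (by positivity)
    rw [sub_pos, Real.sqrt_lt' (by linarith)]
    nlinarith [mul_pos hm hl]
  have p2 : 0 < p.y₂ := by
    unfold y₂
    apply div_pos _ (by positivity)
    rw [sub_pos, Real.sqrt_lt' hT]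
    nlinarith [mul_pos hm hl]
  have key : ∀ y, 0 < y → (y - p.y₂) * (y - p.y₃) = 0 → p.y₁ < y ∧ y < p.y₄ := by
    intro y hy h0
    have e1 := quad_minus h hne y
    have e2 := quad_plus h hne y
    rw [h0] at e1
    have e3 : p.m₂ * ((y - p.y₁) * (y - p.y₄)) < 0 := by nlinarith
    have e4 : (y - p.y₁) * (y - p.y₄) < 0 := by
      by_contra hc
      nlinarith [mul_nonneg hm.le (not_lt.1 hc)]
    rcases mul_neg_iff.1 e4 with ⟨u, v⟩ | ⟨u, v⟩
    · exact ⟨by linarith, by linarith⟩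
    · linarith
  exact ⟨p1, (key _ p2 (by simp)).1, h23, (key _ (p2.trans h23) (by simp)).2⟩

theorem branch_one {p : RWParams} (h : p.Pos) (hs : p.Stable) : p.y₂ < 1 ∧ 1 < p.y₃ := by
  have hlt : p.m₁ < p.lam₁ := hs.first
  have hne : p.m₁ ≠ p.lam₁ ∨ p.m₂ ≠ p.lam₂ := Or.inl hlt.ne
  have h23 := (branch_order h hne).2.2.1
  have e1 := quad_minus h hne 1
  have e2 := two_sqrt_lt h.m₁ h.lam₁ hlt.ne
  have hm := h.m₂
  have e3 : (1 - p.y₂) * (1 - p.y₃) < 0 := by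
    by_contra hc
    have := mul_nonneg hm.le (not_lt.1 hc)
    unfold Tminus S at e1
    linarith
  rcases mul_neg_iff.1 e3 with ⟨u, v⟩ | ⟨u, v⟩
  · exact ⟨by linarith, by linarith⟩
  · linarith

/-- A point where `B` is a real multiple `t y` of `y` with `|t| ≤ 2 √(m₁ λ₁)` lies on the cuts. -/
theorem mem_cuts_of {p : RWParams} (h : p.Pos) (hne : p.m₁ ≠ p.lam₁ ∨ p.m₂ ≠ p.lam₂)
    {y : ℂ} {t : ℝ} (hB : p.B y = t * y) (ht : t ^ 2 ≤ 4 * p.m₁ * p.lam₁) : y ∈ p.cuts := by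
  have hm := h.m₂
  have hq := Real.sq_sqrt (mul_pos h.m₁ h.lam₁).le
  have hq0 := Real.sqrt_nonneg (p.m₁ * p.lam₁)
  have hT : p.Tminus ≤ p.S + t := by
    have := abs_le_of_sq_le_sq' (a := t) (b := 2 * √(p.m₁ * p.lam₁)) (by nlinarith) (by linarith)
    unfold Tminus
    linarith [this.1]
  have hd := disc_pos h hne hT
  have him : y.im = 0 := by
    by_contra hc
    have hre := congrArg Complex.re hB
    have him := congrArg Complex.im hB
    simp [B, pow_two] at hre him
    have e1 : 2 * p.m₂ * y.re = p.S + t := by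
      apply mul_right_cancel₀ hc
      linarith
    have e2 : p.m₂ * (y.re ^ 2 + y.im ^ 2) = p.lam₂ := by
      linear_combination -hre + y.re * e1
    have e3 : (p.S + t) ^ 2 - 4 * p.m₂ * p.lam₂ = -(4 * p.m₂ ^ 2 * y.im ^ 2) := by
      rw [← e1, ← e2]; ring
    have : 0 ≤ 4 * p.m₂ ^ 2 * y.im ^ 2 := by positivity
    linarith
  obtain ⟨r, rfl⟩ : ∃ r : ℝ, y = r := ⟨y.re, by apply Complex.ext <;> simp [him]⟩
  rw [B_ofReal] at hB
  have hB' : p.Breal r = t * r := by exact_mod_cast hB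
  have hD : p.Delta₁real r ≤ 0 := by
    unfold Delta₁real
    rw [hB']
    nlinarith [mul_le_mul_of_nonneg_right ht (sq_nonneg r)]
  rw [Delta₁real_eq h hne] at hD
  obtain ⟨-, h12, h23, h34⟩ := branch_order h hne
  refine ⟨r, ?_, rfl⟩
  have hD' : (r - p.y₁) * (r - p.y₂) * (r - p.y₃) * (r - p.y₄) ≤ 0 := by
    by_contra hc
    have := mul_pos (pow_pos hm 2) (not_le.1 hc)
    linarith
  by_contra hc
  simp only [mem_union, mem_Icc, not_or, not_and, not_le] at hc
  apply absurd hD'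
  rw [not_le]
  rcases lt_or_ge r p.y₁ with a | a
  · have a1 : 0 < p.y₁ - r := by linarith
    have a2 : 0 < p.y₂ - r := by linarith
    have a3 : 0 < p.y₃ - r := by linarith
    have a4 : 0 < p.y₄ - r := by linarith
    calc (0 : ℝ) < (p.y₁ - r) * (p.y₂ - r) * (p.y₃ - r) * (p.y₄ - r) := by positivity
      _ = _ := by ring
  have b2 : 0 < r - p.y₂ := by linarith [hc.1 a]
  have b1 : 0 < r - p.y₁ := by linarith
  rcases lt_or_ge r p.y₃ with a | a
  · have a3 : 0 < p.y₃ - r := by linarith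
    have a4 : 0 < p.y₄ - r := by linarith
    calc (0 : ℝ) < (r - p.y₁) * (r - p.y₂) * (p.y₃ - r) * (p.y₄ - r) := by positivity
      _ = _ := by ring
  · have a4 : 0 < r - p.y₄ := by linarith [hc.2 a]
    have a3 : 0 < r - p.y₃ := by linarith
    positivity

theorem B_ne_zero {p : RWParams} (h : p.Pos) (hne : p.m₁ ≠ p.lam₁ ∨ p.m₂ ≠ p.lam₂)
    {y : ℂ} (hy : y ∉ p.cuts) : p.B y ≠ 0 := fun h0 =>
  hy (mem_cuts_of h hne (t := 0) (by simp [h0]) (by have := h.m₁; have := h.lam₁; simp; positivity))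

theorem div_mem_slitPlane {p : RWParams} (h : p.Pos) (hne : p.m₁ ≠ p.lam₁ ∨ p.m₂ ≠ p.lam₂)
    {y : ℂ} (hy : y ∉ p.cuts) : p.Delta₁ y / p.B y ^ 2 ∈ Complex.slitPlane := by
  have hB := B_ne_zero h hne hy
  by_contra hc
  have hpos := mul_pos h.m₁ h.lam₁
  obtain ⟨s, hs, hw⟩ : ∃ s : ℝ, 0 ≤ s ∧ p.Delta₁ y / p.B y ^ 2 = -(s : ℂ) := by
    rw [Complex.mem_slitPlane_iff, not_or, not_lt, not_not] at hc
    exact ⟨-(p.Delta₁ y / p.B y ^ 2).re, by linarith [hc.1],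
      by apply Complex.ext <;> simp [hc.2]⟩
  rw [div_eq_iff (pow_ne_zero 2 hB)] at hw
  have e : (1 + s : ℂ) * p.B y ^ 2 = 4 * p.m₁ * p.lam₁ * y ^ 2 := by
    unfold Delta₁ at hw
    linear_combination hw
  have hs1 : 0 < 1 + s := by linarith
  have hs1' : (1 + s : ℂ) ≠ 0 := by exact_mod_cast hs1.ne'
  set t : ℝ := √(4 * p.m₁ * p.lam₁ / (1 + s)) with htdef
  have ht2 : t ^ 2 = 4 * p.m₁ * p.lam₁ / (1 + s) :=
    Real.sq_sqrt (div_nonneg (by linarith) hs1.le)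
  have ht2' : (t : ℂ) ^ 2 = 4 * p.m₁ * p.lam₁ / (1 + s) := by exact_mod_cast ht2
  have hle : t ^ 2 ≤ 4 * p.m₁ * p.lam₁ := by
    rw [ht2]
    exact div_le_self (by linarith) (by linarith)
  have e2 : p.B y ^ 2 = (t * y) ^ 2 := by
    rw [mul_pow, ht2']
    field_simp
    linear_combination e
  rcases sq_eq_sq_iff_eq_or_eq_neg.1 e2 with e3 | e3
  · exact hy (mem_cuts_of h hne e3 hle)
  · exact hy (mem_cuts_of h hne (t := -t) (by rw [e3]; push_cast; ring) (by simpa using hle))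

theorem sigma₁_sq {p : RWParams} {y : ℂ} (hB : p.B y ≠ 0) : p.sigma₁ y ^ 2 = p.Delta₁ y := by
  unfold sigma₁
  rw [mul_pow, ← Complex.cpow_nat_mul]
  have e : ((2 : ℕ) : ℂ) * (1 / 2) = 1 := by norm_num
  rw [e, Complex.cpow_one, mul_div_cancel₀ _ (pow_ne_zero 2 hB)]

theorem zero_notMem_cuts {p : RWParams} (h : p.Pos) (hne : p.m₁ ≠ p.lam₁ ∨ p.m₂ ≠ p.lam₂) :
    (0 : ℂ) ∉ p.cuts := by
  obtain ⟨h0, h12, h23, h34⟩ := branch_order h hne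
  rintro ⟨r, hr, hr0⟩
  have hr1 : r = 0 := Complex.ofReal_eq_zero.1 hr0
  subst hr1
  rcases hr with hr | hr
  · linarith [hr.1]
  · linarith [hr.1]

theorem isOpen_compl_cuts (p : RWParams) : IsOpen (p.cutsᶜ) := by
  rw [isOpen_compl_iff]
  exact ((isCompact_Icc.union isCompact_Icc).image Complex.continuous_ofReal).isClosed

/-- `σ₁` is analytic off the cuts. -/
theorem sigma₁_analytic {p : RWParams} (h : p.Pos) (hne : p.m₁ ≠ p.lam₁ ∨ p.m₂ ≠ p.lam₂) :
    AnalyticOnNhd ℂ p.sigma₁ p.cutsᶜ := by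
  apply DifferentiableOn.analyticOnNhd _ p.isOpen_compl_cuts
  intro y hy
  have hB := B_ne_zero h hne hy
  have hdB : DifferentiableAt ℂ p.B y := by unfold B; fun_prop
  have hdD : DifferentiableAt ℂ p.Delta₁ y := by unfold Delta₁ B; fun_prop
  apply DifferentiableAt.differentiableWithinAt
  exact hdB.mul ((hdD.div (hdB.pow 2) (pow_ne_zero 2 hB)).cpow_const
    (div_mem_slitPlane h hne hy))

/-- `σ₁` is `√Δ₁` near the origin. -/
theorem sigma₁_near_zero {p : RWParams} (h : p.Pos) (hne : p.m₁ ≠ p.lam₁ ∨ p.m₂ ≠ p.lam₂) :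
    ∀ᶠ y in 𝓝 (0 : ℂ), p.sigma₁ y = p.Delta₁ y ^ (1 / 2 : ℂ) := by
  have h0 := zero_notMem_cuts h hne
  have hl := h.lam₂
  have hc1 : ContinuousAt p.sigma₁ 0 := (sigma₁_analytic h hne 0 h0).continuousAt
  have hD0 : p.Delta₁ 0 = ((p.lam₂ ^ 2 : ℝ) : ℂ) := by simp [Delta₁, B]
  have hsl : p.Delta₁ 0 ∈ Complex.slitPlane := by
    rw [hD0, Complex.ofReal_mem_slitPlane]; positivity
  have hc2 : ContinuousAt (fun y => p.Delta₁ y ^ (1 / 2 : ℂ)) 0 := by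
    have : ContinuousAt p.Delta₁ 0 := by unfold Delta₁ B; fun_prop
    exact this.cpow continuousAt_const hsl
  have v1 : p.sigma₁ 0 = p.lam₂ := by
    have : (p.lam₂ : ℂ) ≠ 0 := by exact_mod_cast hl.ne'
    simp [sigma₁, Delta₁, B, this]
  have v2 : p.Delta₁ 0 ^ (1 / 2 : ℂ) = p.lam₂ := by
    rw [hD0]
    have : ((p.lam₂ ^ 2 : ℝ) : ℂ) ^ ((1 / 2 : ℝ) : ℂ) = p.lam₂ := by
      rw [← Complex.ofReal_cpow (by positivity), ← Real.sqrt_eq_rpow, Real.sqrt_sq hl.le]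
    simpa using this
  have hc3 : ContinuousAt (fun y => p.sigma₁ y + p.Delta₁ y ^ (1 / 2 : ℂ)) 0 := hc1.add hc2
  have hne0 : p.sigma₁ 0 + p.Delta₁ 0 ^ (1 / 2 : ℂ) ≠ 0 := by
    rw [v1, v2]
    have : (p.lam₂ + p.lam₂ : ℝ) ≠ 0 := by positivity
    exact_mod_cast this
  filter_upwards [hc3.eventually_ne hne0, p.isOpen_compl_cuts.mem_nhds h0] with y hy hy2
  have e1 := sigma₁_sq (B_ne_zero h hne hy2)
  have e2 : (p.Delta₁ y ^ (1 / 2 : ℂ)) ^ 2 = p.Delta₁ y := by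
    rw [← Complex.cpow_nat_mul]
    simp
  rcases sq_eq_sq_iff_eq_or_eq_neg.1 (e1.trans e2.symm) with e3 | e3
  · exact e3
  · exact absurd (by rw [e3]; ring) hy

end RWParams

/-! ### Cauchy integrals over a real segment with a Hölder density. -/

section CauchyIntegralOnSegment

open MeasureTheory intervalIntegral

/-! Write `m₁ = μ₁c₁`, `m₂ = μ₂c₂` and `t(y) = S - m₂y - λ₂/y`. For `y ≠ 0`, `K(x,y) = 0` means
`m₁x² - t(y)x + λ₁ = 0`. On `[y₁,y₂]` one has `|t| ≤ 2√(m₁λ₁)`, with equality of opposite signs at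
the endpoints, so the two roots are conjugate points of the circle, every point of the circle arises
in this way (`exists_lowerPoint`), and `Y₀` takes the value `y` there (`Y₀_eq`).

Existence rests on a change of variable. If `η = Y₀(x)`, the other root of `K(x,·)` is `λ₂/(m₂η)`,
and partial fractions turn the exponent of `φ₁(x)` into `1/π` times minus the Cauchy integral of
`Θ₁` over the cut at `η`, plus a term analytic in `η` near the cut (`phi₁_eq_exp`). When `x` tends
from inside the disc to a point of the open lower half of the circle, `η` tends to `y` from the
upper half-plane (`im_pos_of_K_eq_zero`), and the Plemelj formula produces `-iΘ₁(y)` plus a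
principal value. The formula applies because `Θ₁` is Hölder of exponent 1/2 and vanishes at both
ends of the cut; this vanishing also settles the two real points of the circle. The limit of `X₀`
from above the cut is this same lower point (`tendsto_X₀`).

The other boundary values follow from symmetry: `φ₁` commutes with conjugation and is invariant
under `x ↦ r₁²/x`, so its exterior limit at `x` is the conjugate of its interior limit there. Their
quotient at a lower point is `exp(-2iΘ₁)`, which is `α₁` (`alpha₁_lowerPoint`). Inversion also
carries `φ₁(0) = 1` to infinity.

For uniqueness, the quotient of a solution by the nonvanishing `φ₁` has equal limits from the two
sides of the circle and tends to 1 at infinity; Cauchy's formula on growing circles makes it 1 in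
the disc (`eq_one_of_matching_limits`). -/

theorem intervalIntegrable_sqrt_abs_div_abs (a b : ℝ) :
    IntervalIntegrable (fun u : ℝ => √|u| / |u|) volume a b := by
  apply intervalIntegrable_of_even (by simp)
  intro x hx
  refine (intervalIntegrable_rpow' (r := -(1 / 2)) (by norm_num)).congr ?_
  intro u hu
  rw [uIoc_of_le hx.le] at hu
  have h0 : 0 < u := hu.1
  simp only [abs_of_pos h0]
  rw [Real.rpow_neg h0.le, ← Real.sqrt_eq_rpow]
  have := Real.mul_self_sqrt h0.le
  have h1 := (Real.sqrt_pos.2 h0).ne'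
  field_simp
  nlinarith

theorem continuous_of_sqrt_modulus {f : ℝ → ℝ} {C : ℝ}
    (hf : ∀ s t, |f s - f t| ≤ C * √|s - t|) : Continuous f := by
  rw [continuous_iff_continuousAt]
  intro t
  rw [ContinuousAt, tendsto_iff_dist_tendsto_zero]
  refine squeeze_zero (fun _ => dist_nonneg) (fun s => hf s t) ?_
  have : Continuous fun s => C * √|s - t| := by fun_prop
  have h := this.tendsto t
  simp only [sub_self, abs_zero, Real.sqrt_zero, mul_zero] at h
  exact h

theorem ofReal_sub_mul_I_ne_zero {u b : ℝ} (hu : u ≠ 0 ∨ b ≠ 0) :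
    (u : ℂ) - b * Complex.I ≠ 0 := by
  intro h
  have h1 := congrArg Complex.re h
  have h2 := congrArg Complex.im h
  simp at h1 h2
  tauto

/-- The Hilbert transform of `f` at `y`, truncated at distance `M`, in regularized form. -/
noncomputable def truncHilbert (f : ℝ → ℝ) (M y : ℝ) : ℝ :=
  ∫ u in -M..M, (f (y + u) - f y) / u

/-- Subtracting the value at `Re η` makes the integrand at most `C |u|^(-1/2)` uniformly in `η`,
because `|u - i Im η| ≥ |u|`. Dominated convergence then holds for an unrestricted approach to `y`.
-/
theorem tendsto_regularized_cauchy {f : ℝ → ℝ} {C : ℝ}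
    (hf : ∀ s t, |f s - f t| ≤ C * √|s - t|) (M y : ℝ) :
    Tendsto (fun η : ℂ => ∫ u in -M..M,
      ((f (η.re + u) - f η.re : ℝ) : ℂ) / (u - η.im * Complex.I)) (𝓝 (y : ℂ))
      (𝓝 (truncHilbert f M y : ℂ)) := by
  have hc := continuous_of_sqrt_modulus hf
  have e : (truncHilbert f M y : ℂ) = ∫ u in -M..M, ((f (y + u) - f y : ℝ) : ℂ) / u := by
    unfold truncHilbert
    rw [← integral_ofReal]
    simp
  rw [e]
  apply intervalIntegral.tendsto_integral_filter_of_dominated_convergence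
    (fun u => C * (√|u| / |u|))
  · refine Eventually.of_forall fun η => Measurable.aestronglyMeasurable ?_
    have : Measurable fun u => f (η.re + u) - f η.re := by fun_prop
    exact (Complex.measurable_ofReal.comp this).div
      (Complex.measurable_ofReal.sub measurable_const)
  · refine Eventually.of_forall fun η => ?_
    filter_upwards [compl_mem_ae_iff.2 (measure_singleton (0 : ℝ))] with u hu _
    have hu : u ≠ 0 := hu
    have h1 : |u| ≤ ‖(u : ℂ) - η.im * Complex.I‖ := by
      have := Complex.abs_re_le_norm ((u : ℂ) - η.im * Complex.I)
      simpa using this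
    have h2 : |f (η.re + u) - f η.re| ≤ C * √|u| := by simpa using hf (η.re + u) η.re
    rw [norm_div, Complex.norm_real, Real.norm_eq_abs, mul_div_assoc']
    have := abs_pos.2 hu
    gcongr
    exact (abs_nonneg _).trans h2
  · exact (intervalIntegrable_sqrt_abs_div_abs _ _).const_mul C
  · filter_upwards [compl_mem_ae_iff.2 (measure_singleton (0 : ℝ))] with u hu _
    have hu : u ≠ 0 := hu
    have hc1 : ContinuousAt (fun η : ℂ =>
        ((f (η.re + u) - f η.re : ℝ) : ℂ) / (u - η.im * Complex.I)) (y : ℂ) := by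
      apply ContinuousAt.div
      · have : Continuous fun η : ℂ => ((f (η.re + u) - f η.re : ℝ) : ℂ) := by fun_prop
        exact this.continuousAt
      · fun_prop
      · exact ofReal_sub_mul_I_ne_zero (Or.inl hu)
    simpa [ContinuousAt] using hc1

theorem integral_one_div_sub_mul_I {b : ℝ} (hb : b ≠ 0) (M : ℝ) :
    ∫ u in -M..M, (1 : ℂ) / (u - b * Complex.I) = 2 * Real.arctan (M / b) * Complex.I := by
  -- The real part of this primitive is even in `u` and cancels between `-M` and `M`; only the
  -- arctangent remains.
  have hd : ∀ u : ℝ, HasDerivAt (fun u : ℝ =>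
      ((Real.log (u ^ 2 + b ^ 2) / 2 : ℝ) : ℂ) + (Real.arctan (u / b) : ℝ) * Complex.I)
      (1 / (u - b * Complex.I)) u := by
    intro u
    have hp : 0 < u ^ 2 + b ^ 2 := by positivity
    have h1 : HasDerivAt (fun u : ℝ => Real.log (u ^ 2 + b ^ 2) / 2)
        (u / (u ^ 2 + b ^ 2)) u := by
      have h := (((hasDerivAt_pow 2 u).add_const (b ^ 2)).log hp.ne').div_const 2
      refine h.congr_deriv ?_
      push_cast
      field_simp
    have h2 : HasDerivAt (fun u : ℝ => Real.arctan (u / b)) (b / (u ^ 2 + b ^ 2)) u := by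
      have h := ((hasDerivAt_id u).div_const b).arctan
      refine h.congr_deriv ?_
      simp only [id]
      field_simp
      ring
    have h3 := h1.ofReal_comp.add (h2.ofReal_comp.mul_const Complex.I)
    refine h3.congr_deriv ?_
    have hne := ofReal_sub_mul_I_ne_zero (u := u) (Or.inr hb)
    have hne2 : (u : ℂ) ^ 2 + b ^ 2 ≠ 0 := by exact_mod_cast hp.ne'
    push_cast
    field_simp
    linear_combination -((b : ℂ) ^ 2) * Complex.I_sq
  rw [integral_eq_sub_of_hasDerivAt (fun u _ => hd u)]
  · simp [neg_div, Real.arctan_neg]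
    ring
  · apply Continuous.intervalIntegrable
    apply Continuous.div (by fun_prop) (by fun_prop)
    exact fun u => ofReal_sub_mul_I_ne_zero (Or.inr hb)

theorem cauchy_integral_shift {f : ℝ → ℝ} {a b M : ℝ} (hs : ∀ t, t ∉ Ioo a b → f t = 0)
    {η : ℂ} (h1 : η.re - M < a) (h2 : b < η.re + M) :
    ∫ ξ in a..b, (f ξ : ℂ) / (ξ - η) =
      ∫ u in -M..M, (f (η.re + u) : ℂ) / (u - η.im * Complex.I) := by
  have e : ∀ u : ℝ, (f (η.re + u) : ℂ) / (u - η.im * Complex.I) =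
      (fun ξ : ℝ => (f ξ : ℂ) / (ξ - η)) (η.re + u) := by
    intro u
    have : ((η.re + u : ℝ) : ℂ) - η = u - η.im * Complex.I := by
      apply Complex.ext <;> simp
    simp only [this]
  simp_rw [e]
  rw [integral_comp_add_left (fun ξ : ℝ => (f ξ : ℂ) / (ξ - η))]
  have hsub : Function.support (fun ξ : ℝ => (f ξ : ℂ) / (ξ - η)) ⊆ Ioo a b := by
    intro ξ hξ
    by_contra hc
    simp [hs ξ hc] at hξ
  rw [integral_eq_integral_of_support_subset (hsub.trans Ioo_subset_Ioc_self),
    integral_eq_integral_of_support_subset]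
  intro ξ hξ
  have := hsub hξ
  exact ⟨by linarith [this.1], by linarith [this.2]⟩

/-- This isolates the jump: the first term is continuous in `η` across the real axis, while the
arctangent tends to `±π/2` according to the side of approach. -/
theorem cauchy_integral_decomp {f : ℝ → ℝ} {a b M : ℝ} (hc : Continuous f)
    (hs : ∀ t, t ∉ Ioo a b → f t = 0)
    {η : ℂ} (h1 : η.re - M < a) (h2 : b < η.re + M)
    (hη : η.im = 0 → f η.re = 0) :
    ∫ ξ in a..b, (f ξ : ℂ) / (ξ - η) =
      (∫ u in -M..M, ((f (η.re + u) - f η.re : ℝ) : ℂ) / (u - η.im * Complex.I)) +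
        f η.re * (2 * Real.arctan (M / η.im) * Complex.I) := by
  rw [cauchy_integral_shift hs h1 h2]
  by_cases him : η.im = 0
  · simp [hη him]
  · rw [← integral_one_div_sub_mul_I him, ← intervalIntegral.integral_const_mul,
      ← intervalIntegral.integral_add]
    · apply intervalIntegral.integral_congr
      intro u _
      simp only
      push_cast
      ring
    · apply Continuous.intervalIntegrable
      apply Continuous.div (by fun_prop) (by fun_prop)
      exact fun u => ofReal_sub_mul_I_ne_zero (Or.inr him)
    · apply Continuous.intervalIntegrable
      apply Continuous.mul (by fun_prop)
      apply Continuous.div (by fun_prop) (by fun_prop)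
      exact fun u => ofReal_sub_mul_I_ne_zero (Or.inr him)

theorem eventually_re_near (a b : ℝ) {y : ℝ} (hy : y ∈ Icc a b) :
    ∀ᶠ η : ℂ in 𝓝 (y : ℂ), η.re - (b - a + 1) < a ∧ b < η.re + (b - a + 1) := by
  have hc : Tendsto (fun η : ℂ => η.re) (𝓝 (y : ℂ)) (𝓝 y) := by
    simpa using Complex.continuous_re.tendsto (y : ℂ)
  filter_upwards [hc.eventually (lt_mem_nhds (show y - 1 < y by linarith)),
    hc.eventually (gt_mem_nhds (show y < y + 1 by linarith))] with η h1 h2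
  exact ⟨by linarith [hy.2], by linarith [hy.1]⟩

/-- **Plemelj formula**: the limit of a Cauchy integral from the upper half-plane. -/
theorem tendsto_cauchy_integral_upper {f : ℝ → ℝ} {C a b y : ℝ}
    (hf : ∀ s t, |f s - f t| ≤ C * √|s - t|) (hs : ∀ t, t ∉ Ioo a b → f t = 0)
    (hy : y ∈ Icc a b) :
    Tendsto (fun η : ℂ => ∫ ξ in a..b, (f ξ : ℂ) / (ξ - η)) (𝓝[{η | 0 < η.im}] (y : ℂ))
      (𝓝 (truncHilbert f (b - a + 1) y + f y * (Real.pi * Complex.I))) := by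
  have hc := continuous_of_sqrt_modulus hf
  have hM : 0 < b - a + 1 := by linarith [hy.1.trans hy.2]
  have t1 := (tendsto_regularized_cauchy hf (b - a + 1) y).mono_left
    (nhdsWithin_le_nhds (s := {η : ℂ | 0 < η.im}))
  have t2 : Tendsto (fun η : ℂ => (f η.re : ℂ)) (𝓝[{η | 0 < η.im}] (y : ℂ)) (𝓝 (f y)) := by
    have : Continuous fun η : ℂ => (f η.re : ℂ) := by fun_prop
    simpa using (this.tendsto (y : ℂ)).mono_left nhdsWithin_le_nhds
  have t3 : Tendsto (fun η : ℂ => η.im) (𝓝[{η | 0 < η.im}] (y : ℂ)) (𝓝[>] 0) := by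
    apply tendsto_nhdsWithin_of_tendsto_nhds_of_eventually_within
    · simpa using (Complex.continuous_im.tendsto (y : ℂ)).mono_left nhdsWithin_le_nhds
    · exact self_mem_nhdsWithin
  have t4 : Tendsto (fun η : ℂ => (Real.arctan ((b - a + 1) / η.im) : ℂ))
      (𝓝[{η | 0 < η.im}] (y : ℂ)) (𝓝 ((Real.pi / 2 : ℝ) : ℂ)) := by
    apply (Complex.continuous_ofReal.tendsto _).comp
    have h5 : Tendsto (fun η : ℂ => (b - a + 1) / η.im) (𝓝[{η | 0 < η.im}] (y : ℂ)) atTop := by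
      simpa [div_eq_mul_inv] using (tendsto_inv_nhdsGT_zero.comp t3).const_mul_atTop hM
    exact (Real.tendsto_arctan_atTop.mono_right nhdsWithin_le_nhds).comp h5
  have t5 := t1.add (t2.mul ((t4.const_mul 2).mul_const Complex.I))
  have e : (2 : ℂ) * ((Real.pi / 2 : ℝ) : ℂ) * Complex.I = Real.pi * Complex.I := by
    push_cast; ring
  rw [e] at t5
  refine t5.congr' ?_
  filter_upwards [self_mem_nhdsWithin, nhdsWithin_le_nhds (eventually_re_near a b hy)] with η h1 h2
  exact (cauchy_integral_decomp hc hs h2.1 h2.2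
    fun h => absurd h (ne_of_gt (show 0 < η.im from h1))).symm

/-- A Cauchy integral whose density vanishes at `y` is continuous at `y` off the segment. -/
theorem tendsto_cauchy_integral_of_eq_zero {f : ℝ → ℝ} {C a b y : ℝ}
    (hf : ∀ s t, |f s - f t| ≤ C * √|s - t|) (hs : ∀ t, t ∉ Ioo a b → f t = 0)
    (hy : y ∈ Icc a b) (hfy : f y = 0) :
    Tendsto (fun η : ℂ => ∫ ξ in a..b, (f ξ : ℂ) / (ξ - η))
      (𝓝[{η | η.im = 0 → η.re ∉ Ioo a b}] (y : ℂ))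
      (𝓝 (truncHilbert f (b - a + 1) y : ℂ)) := by
  have hc := continuous_of_sqrt_modulus hf
  have t1 := (tendsto_regularized_cauchy hf (b - a + 1) y).mono_left
    (nhdsWithin_le_nhds (s := {η : ℂ | η.im = 0 → η.re ∉ Ioo a b}))
  have t2 : Tendsto (fun η : ℂ =>
      (f η.re : ℂ) * (2 * Real.arctan ((b - a + 1) / η.im) * Complex.I))
      (𝓝[{η | η.im = 0 → η.re ∉ Ioo a b}] (y : ℂ)) (𝓝 0) := by
    have h0 : Tendsto (fun η : ℂ => |f η.re| * Real.pi)
        (𝓝[{η | η.im = 0 → η.re ∉ Ioo a b}] (y : ℂ)) (𝓝 0) := by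
      have : Continuous fun η : ℂ => |f η.re| * Real.pi := by fun_prop
      simpa [hfy] using (this.tendsto (y : ℂ)).mono_left nhdsWithin_le_nhds
    -- The arctangent may oscillate with the sign of `Im η`, but it is bounded and its factor `f (Re
    -- η)` tends to `f y = 0`.
    refine squeeze_zero_norm (fun η => ?_) h0
    have h1 := Real.arctan_lt_pi_div_two ((b - a + 1) / η.im)
    have h2 := Real.neg_pi_div_two_lt_arctan ((b - a + 1) / η.im)
    rw [norm_mul, norm_mul, norm_mul, Complex.norm_real, Complex.norm_real, Complex.norm_I,
      mul_one, Real.norm_eq_abs, Real.norm_eq_abs]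
    gcongr
    have : |Real.arctan ((b - a + 1) / η.im)| ≤ Real.pi / 2 := abs_le.2 ⟨by linarith, h1.le⟩
    simp
    linarith
  have t5 := t1.add t2
  rw [add_zero] at t5
  refine t5.congr' ?_
  filter_upwards [self_mem_nhdsWithin, nhdsWithin_le_nhds (eventually_re_near a b hy)] with η h1 h2
  exact (cauchy_integral_decomp hc hs h2.1 h2.2 fun h => hs _ (h1 h)).symm

/-- The truncated Hilbert transform is a Cauchy principal value. -/
theorem tendsto_truncated_cauchy {f : ℝ → ℝ} {C a b y : ℝ}
    (hf : ∀ s t, |f s - f t| ≤ C * √|s - t|) (hs : ∀ t, t ∉ Ioo a b → f t = 0)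
    (hy : y ∈ Icc a b) :
    Tendsto (fun ε : ℝ => ∫ ξ in Icc a b \ Ioo (y - ε) (y + ε), f ξ / (ξ - y)) (𝓝[>] 0)
      (𝓝 (truncHilbert f (b - a + 1) y)) := by
  have hc := continuous_of_sqrt_modulus hf
  set M := b - a + 1 with hM
  have hab := hy.1.trans hy.2
  have hset : ∀ ε : ℝ, MeasurableSet {u : ℝ | ε ≤ |u|} := fun ε =>
    measurableSet_le measurable_const (by fun_prop)
  have key : ∀ ε : ℝ, 0 < ε → ∫ ξ in Icc a b \ Ioo (y - ε) (y + ε), f ξ / (ξ - y) =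
      ∫ u in -M..M, {u : ℝ | ε ≤ |u|}.indicator (fun u => (f (y + u) - f y) / u) u := by
    intro ε hε
    have hint : ∀ g : ℝ → ℝ, Continuous g → IntervalIntegrable
        (fun u => {u : ℝ | ε ≤ |u|}.indicator (fun u => g u / u) u) volume (-M) M := by
      intro g hg
      rw [intervalIntegrable_iff]
      have h1 : IntegrableOn (fun u => |g u| / ε) (uIoc (-M) M) := by
        have : Continuous fun u => |g u| / ε := by fun_prop
        exact (intervalIntegrable_iff.1 (this.intervalIntegrable _ _))
      refine h1.mono' ?_ ?_
      · exact (Measurable.indicator (by fun_prop) (hset ε)).aestronglyMeasurable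
      · refine Eventually.of_forall fun u => ?_
        by_cases hu : ε ≤ |u|
        · rw [indicator_of_mem (show u ∈ {u : ℝ | ε ≤ |u|} from hu), norm_div, Real.norm_eq_abs,
            Real.norm_eq_abs]
          gcongr
        · rw [indicator_of_notMem (show u ∉ {u : ℝ | ε ≤ |u|} from hu), norm_zero]
          positivity
    -- The window is symmetric about `y`, so subtracting `f y` from the density changes nothing and
    -- leaves an integrable singularity.
    have hodd : ∫ u in -M..M, {u : ℝ | ε ≤ |u|}.indicator (fun u => f y / u) u = 0 := by
      have h1 := integral_comp_neg (a := -M) (b := M)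
        (fun u => {u : ℝ | ε ≤ |u|}.indicator (fun u => f y / u) u)
      rw [neg_neg] at h1
      have h2 : ∀ u : ℝ, {u : ℝ | ε ≤ |u|}.indicator (fun u => f y / u) (-u) =
          -{u : ℝ | ε ≤ |u|}.indicator (fun u => f y / u) u := by
        intro u
        by_cases hu : ε ≤ |u|
        · simp [indicator, hu, div_neg]
        · simp [indicator, hu]
      simp_rw [h2] at h1
      rw [intervalIntegral.integral_neg] at h1
      linarith
    have e1 : ∀ u : ℝ, {u : ℝ | ε ≤ |u|}.indicator (fun u => (f (y + u) - f y) / u) u =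
        {u : ℝ | ε ≤ |u|}.indicator (fun u => f (y + u) / u) u -
          {u : ℝ | ε ≤ |u|}.indicator (fun u => f y / u) u := by
      intro u
      by_cases hu : ε ≤ |u|
      · simp [indicator, hu, sub_div]
      · simp [indicator, hu]
    simp_rw [e1]
    rw [intervalIntegral.integral_sub (hint _ (by fun_prop)) (hint _ (by fun_prop)), hodd,
      sub_zero]
    have e2 : ∀ u : ℝ, {u : ℝ | ε ≤ |u|}.indicator (fun u => f (y + u) / u) u =
        (fun ξ => (Ioo (y - ε) (y + ε))ᶜ.indicator (fun ξ => f ξ / (ξ - y)) ξ) (y + u) := by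
      intro u
      have : y + u ∈ (Ioo (y - ε) (y + ε))ᶜ ↔ ε ≤ |u| := by
        rw [mem_compl_iff, mem_Ioo, ← not_lt, abs_lt]
        constructor <;> intro h h' <;> apply h <;> constructor <;> linarith [h'.1, h'.2]
      by_cases hu : ε ≤ |u|
      · simp only
        rw [indicator_of_mem (this.2 hu), indicator_of_mem (by exact hu)]
        simp
      · simp only
        rw [indicator_of_notMem (fun h => hu (this.1 h)), indicator_of_notMem (by exact hu)]
    simp_rw [e2]
    rw [integral_comp_add_left
      (fun ξ => (Ioo (y - ε) (y + ε))ᶜ.indicator (fun ξ => f ξ / (ξ - y)) ξ),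
      integral_eq_integral_of_support_subset, sdiff_eq, ← setIntegral_indicator
        measurableSet_Ioo.compl, setIntegral_eq_integral_of_forall_compl_eq_zero]
    · intro ξ hξ
      have : f ξ = 0 := hs ξ fun h => hξ (Ioo_subset_Icc_self h)
      simp [indicator, this]
    · intro ξ hξ
      have : ξ ∈ Ioo a b := by
        by_contra h
        simp [hs ξ h] at hξ
      exact ⟨by linarith [this.1, hy.2], by linarith [this.2, hy.1]⟩
  have hlim : Tendsto (fun ε : ℝ => ∫ u in -M..M,
      {u : ℝ | ε ≤ |u|}.indicator (fun u => (f (y + u) - f y) / u) u) (𝓝[>] 0)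
      (𝓝 (truncHilbert f M y)) := by
    apply intervalIntegral.tendsto_integral_filter_of_dominated_convergence
      (fun u => C * (√|u| / |u|))
    · refine Eventually.of_forall fun ε => ?_
      exact (Measurable.indicator (by fun_prop) (hset ε)).aestronglyMeasurable
    · refine Eventually.of_forall fun ε => Eventually.of_forall fun u _ => ?_
      have h2 : |f (y + u) - f y| ≤ C * √|u| := by simpa using hf (y + u) y
      refine (norm_indicator_le_norm_self _ _).trans ?_
      rw [norm_div, Real.norm_eq_abs, Real.norm_eq_abs, mul_div_assoc']
      gcongr
    · exact (intervalIntegrable_sqrt_abs_div_abs _ _).const_mul C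
    · filter_upwards [compl_mem_ae_iff.2 (measure_singleton (0 : ℝ))] with u hu _
      have hu : 0 < |u| := abs_pos.2 hu
      refine tendsto_const_nhds.congr' ?_
      filter_upwards [nhdsWithin_le_nhds (gt_mem_nhds hu)] with ε hε
      rw [indicator_of_mem (show u ∈ {u : ℝ | ε ≤ |u|} from hε.le)]
  refine hlim.congr' ?_
  filter_upwards [self_mem_nhdsWithin] with ε hε
  exact (key ε hε).symm

end CauchyIntegralOnSegment

/-! ### The kernel over the cut `[y₁, y₂]`. -/

namespace RWParams

variable {p : RWParams}

/-- The value `S - m₂ y - λ₂ / y` which `m₁ x + λ₁ / x` takes at the zeros `x` of `K(·, y)`. -/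
noncomputable def kernelTrace (p : RWParams) (y : ℝ) : ℝ := p.S - p.m₂ * y - p.lam₂ / y

theorem Stable.ne (hs : p.Stable) : p.m₁ ≠ p.lam₁ ∨ p.m₂ ≠ p.lam₂ := Or.inl (ne_of_lt hs.first)

theorem kernelTrace_mul {y : ℝ} (hy : y ≠ 0) : p.kernelTrace y * y = -p.Breal y := by
  unfold kernelTrace Breal
  field_simp
  ring

theorem Pos.r₁_pos (h : p.Pos) : 0 < p.r₁ := Real.sqrt_pos.2 (div_pos h.lam₁ h.m₁)

theorem Pos.r₁_sq (h : p.Pos) : p.r₁ ^ 2 = p.lam₁ / p.m₁ :=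
  Real.sq_sqrt (div_pos h.lam₁ h.m₁).le

theorem pos_of_mem (h : p.Pos) (hs : p.Stable) {y : ℝ} (hy : y ∈ Icc p.y₁ p.y₂) : 0 < y :=
  (branch_order h hs.ne).1.trans_le hy.1

/-- By Vieta `m₂ y₂ y₃ = λ₂`, and `y₂ < y₃`. Hence, over the cut, `y` is the smaller of the two
roots `y` and `λ₂/(m₂y)`. -/
theorem m₂_mul_y₂_sq_lt (h : p.Pos) (hs : p.Stable) : p.m₂ * p.y₂ ^ 2 < p.lam₂ := by
  obtain ⟨h0, h12, h23, h34⟩ := branch_order h hs.ne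
  have e := quad_minus h hs.ne 0
  have hm := h.m₂
  have : p.lam₂ = p.m₂ * (p.y₂ * p.y₃) := by linarith
  rw [this, sq]
  have := h0.trans h12
  gcongr

theorem m₂_mul_mul_le (h : p.Pos) (hs : p.Stable) {y ξ : ℝ} (hy : y ∈ Icc p.y₁ p.y₂)
    (hξ : ξ ∈ Icc p.y₁ p.y₂) : p.m₂ * y * ξ ≤ p.m₂ * p.y₂ ^ 2 := by
  have h1 := pos_of_mem h hs hy
  have h2 := pos_of_mem h hs hξ
  have hm := h.m₂
  rw [sq, ← mul_assoc]
  have := h1.trans_le hy.2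
  gcongr
  exacts [hy.2, hξ.2]

theorem m₂_mul_mul_lt (h : p.Pos) (hs : p.Stable) {y ξ : ℝ} (hy : y ∈ Icc p.y₁ p.y₂)
    (hξ : ξ ∈ Icc p.y₁ p.y₂) : p.m₂ * y * ξ < p.lam₂ :=
  (m₂_mul_mul_le h hs hy hξ).trans_lt (m₂_mul_y₂_sq_lt h hs)

/-- On the cut the quadratic with `Tminus` is nonnegative and the one with `Tplus` is nonpositive;
dividing both by `y > 0` gives the two bounds. -/
theorem abs_kernelTrace_le (h : p.Pos) (hs : p.Stable) {y : ℝ} (hy : y ∈ Icc p.y₁ p.y₂) :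
    |p.kernelTrace y| ≤ 2 * √(p.m₁ * p.lam₁) := by
  have h0 := pos_of_mem h hs hy
  obtain ⟨-, h12, h23, h34⟩ := branch_order h hs.ne
  have e1 := quad_minus h hs.ne y
  have e2 := quad_plus h hs.ne y
  have e3 := kernelTrace_mul (p := p) h0.ne'
  have s1 : 0 ≤ p.m₂ * ((y - p.y₂) * (y - p.y₃)) :=
    mul_nonneg h.m₂.le (mul_nonneg_of_nonpos_of_nonpos (by linarith [hy.2]) (by linarith [hy.2]))
  have s2 : p.m₂ * ((y - p.y₁) * (y - p.y₄)) ≤ 0 :=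
    mul_nonpos_of_nonneg_of_nonpos h.m₂.le
      (mul_nonpos_of_nonneg_of_nonpos (by linarith [hy.1]) (by linarith [hy.2]))
  unfold Tminus at e1
  unfold Tplus at e2
  unfold Breal at e3
  rw [abs_le]
  constructor
  · apply le_of_mul_le_mul_right _ h0
    linarith
  · apply le_of_mul_le_mul_right _ h0
    linarith

theorem kernelTrace_sq_le (h : p.Pos) (hs : p.Stable) {y : ℝ} (hy : y ∈ Icc p.y₁ p.y₂) :
    p.kernelTrace y ^ 2 ≤ 4 * (p.m₁ * p.lam₁) := by
  have h1 := sq_le_sq.2 ((abs_kernelTrace_le h hs hy).trans (le_abs_self _))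
  rwa [mul_pow, Real.sq_sqrt (mul_pos h.m₁ h.lam₁).le, show (2 : ℝ) ^ 2 = 4 by norm_num] at h1

theorem kernelTrace_y₁ (h : p.Pos) (hs : p.Stable) :
    p.kernelTrace p.y₁ = -(2 * √(p.m₁ * p.lam₁)) := by
  have h0 := (branch_order h hs.ne).1
  have e2 := quad_plus h hs.ne p.y₁
  have e3 := kernelTrace_mul (p := p) h0.ne'
  unfold Tplus at e2
  unfold Breal at e3
  apply mul_right_cancel₀ h0.ne'
  linarith

theorem kernelTrace_y₂ (h : p.Pos) (hs : p.Stable) :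
    p.kernelTrace p.y₂ = 2 * √(p.m₁ * p.lam₁) := by
  have h0 := (branch_order h hs.ne).1.trans (branch_order h hs.ne).2.1
  have e2 := quad_minus h hs.ne p.y₂
  have e3 := kernelTrace_mul (p := p) h0.ne'
  unfold Tminus at e2
  unfold Breal at e3
  apply mul_right_cancel₀ h0.ne'
  linarith

theorem exists_kernelTrace_eq (h : p.Pos) (hs : p.Stable) {t : ℝ}
    (ht : t ^ 2 ≤ 4 * (p.m₁ * p.lam₁)) : ∃ y ∈ Icc p.y₁ p.y₂, p.kernelTrace y = t := by
  have hc : ContinuousOn p.kernelTrace (Icc p.y₁ p.y₂) := by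
    unfold kernelTrace
    exact ContinuousOn.sub (by fun_prop)
      (continuousOn_const.div continuousOn_id fun y hy => (pos_of_mem h hs hy).ne')
  have h12 := (branch_order h hs.ne).2.1
  have hiv := intermediate_value_Icc h12.le hc
  rw [kernelTrace_y₁ h hs, kernelTrace_y₂ h hs] at hiv
  have hq := Real.sq_sqrt (mul_pos h.m₁ h.lam₁).le
  have := abs_le_of_sq_le_sq' (a := t) (b := 2 * √(p.m₁ * p.lam₁)) (by nlinarith) (by positivity)
  exact hiv this

/-! ### The density `Θ₁` -/

theorem Theta₁_denom (p : RWParams) {y : ℝ} (hy : y ≠ 0) :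
    p.m₂ * y ^ 2 - p.S * y + 2 * p.lam₁ + p.lam₂ = 2 * p.lam₁ - p.kernelTrace y * y := by
  rw [kernelTrace_mul hy]
  unfold Breal
  ring

/-- Since `y ≤ y₂ < 1`, the term `t(y) y` is at most `2√(m₁λ₁)`. The lower bound is positive because
`m₁ < λ₁`, so the denominator never vanishes and the arctangent is a continuous choice of the angle.
-/
theorem Theta₁_denom_ge (h : p.Pos) (hs : p.Stable) {y : ℝ} (hy : y ∈ Icc p.y₁ p.y₂) :
    2 * p.lam₁ - 2 * √(p.m₁ * p.lam₁) ≤ p.m₂ * y ^ 2 - p.S * y + 2 * p.lam₁ + p.lam₂ := by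
  have h0 := pos_of_mem h hs hy
  rw [Theta₁_denom p h0.ne']
  have h1 : y ≤ 1 := hy.2.trans (branch_one h hs).1.le
  have h2 := (abs_le.1 (abs_kernelTrace_le h hs hy)).2
  have h3 := Real.sqrt_nonneg (p.m₁ * p.lam₁)
  have h4 : p.kernelTrace y * y ≤ (2 * √(p.m₁ * p.lam₁)) * 1 := by gcongr
  linarith

theorem two_lam_sub_pos (h : p.Pos) (hs : p.Stable) :
    0 < 2 * p.lam₁ - 2 * √(p.m₁ * p.lam₁) := by
  have h1 : p.m₁ < p.lam₁ := hs.first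
  have h2 := two_sqrt_lt h.m₁ h.lam₁ h1.ne
  linarith

theorem neg_Delta₁real_eq (p : RWParams) {y : ℝ} (hy : y ≠ 0) :
    -p.Delta₁real y = y ^ 2 * (4 * (p.m₁ * p.lam₁) - p.kernelTrace y ^ 2) := by
  have e := kernelTrace_mul (p := p) hy
  unfold Delta₁real
  linear_combination (p.kernelTrace y * y - p.Breal y) * e

theorem sqrt_neg_Delta₁real_eq (p : RWParams) {y : ℝ} (hy : 0 < y) :
    √(-p.Delta₁real y) = y * √(4 * (p.m₁ * p.lam₁) - p.kernelTrace y ^ 2) := by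
  rw [neg_Delta₁real_eq p hy.ne', Real.sqrt_mul (sq_nonneg y), Real.sqrt_sq hy.le]

theorem Theta₁_eq_zero_of_Delta {y : ℝ} (hD : p.Delta₁real y = 0) : p.Theta₁ y = 0 := by
  simp [Theta₁, hD]

theorem Theta₁_y₁ (h : p.Pos) (hs : p.Stable) : p.Theta₁ p.y₁ = 0 := by
  apply Theta₁_eq_zero_of_Delta
  rw [Delta₁real_eq h hs.ne]
  ring

theorem Theta₁_y₂ (h : p.Pos) (hs : p.Stable) : p.Theta₁ p.y₂ = 0 := by
  apply Theta₁_eq_zero_of_Delta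
  rw [Delta₁real_eq h hs.ne]
  ring

end RWParams

/-! ### Hölder estimates of exponent 1/2. -/

theorem abs_arctan_sub_arctan_le (a b : ℝ) : |Real.arctan a - Real.arctan b| ≤ |a - b| := by
  have h : LipschitzWith 1 Real.arctan := by
    apply lipschitzWith_of_nnnorm_deriv_le Real.differentiable_arctan
    intro x
    rw [← NNReal.coe_le_coe, coe_nnnorm, Real.deriv_arctan, Real.norm_eq_abs, NNReal.coe_one]
    have : 0 < 1 + x ^ 2 := by positivity
    rw [abs_of_pos (by positivity), div_le_one this]
    nlinarith [sq_nonneg x]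
  simpa [Real.dist_eq] using h.dist_le_mul a b

theorem abs_sqrt_sub_sqrt_le (a b : ℝ) : |√a - √b| ≤ √|a - b| := by
  wlog hab : b ≤ a generalizing a b
  · rw [abs_sub_comm, abs_sub_comm a]
    exact this b a (le_of_not_ge hab)
  rw [abs_of_nonneg (sub_nonneg.2 (Real.sqrt_le_sqrt hab)), abs_of_nonneg (sub_nonneg.2 hab),
    sub_le_iff_le_add]
  rcases le_total b 0 with hb | hb
  · rw [Real.sqrt_eq_zero_of_nonpos hb, add_zero]
    exact Real.sqrt_le_sqrt (by linarith)
  · apply Real.sqrt_le_iff.2 ⟨by positivity, ?_⟩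
    have h1 := Real.sq_sqrt hb
    have h2 := Real.sq_sqrt (sub_nonneg.2 hab)
    nlinarith [mul_nonneg (Real.sqrt_nonneg (a - b)) (Real.sqrt_nonneg b)]

theorem ContDiff.exists_abs_sub_le_on_Icc {f : ℝ → ℝ} (hf : ContDiff ℝ 1 f) (a b : ℝ) :
    ∃ L : ℝ, 0 ≤ L ∧ ∀ s ∈ Icc a b, ∀ t ∈ Icc a b, |f s - f t| ≤ L * |s - t| := by
  obtain ⟨L, hL⟩ := LocallyLipschitzOn.exists_lipschitzOnWith_of_compact isCompact_Icc
    (hf.locallyLipschitz.locallyLipschitzOn (s := Icc a b))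
  exact ⟨L, L.2, fun s hs t ht => by simpa [Real.dist_eq] using hL.dist_le_mul s hs t ht⟩

/-- An angle `arctan (√g / d)` with smooth `g` and `d ≥ δ > 0` is Hölder of exponent `1/2`. -/
theorem exists_sqrt_modulus_arctan {g d : ℝ → ℝ} (hg : ContDiff ℝ 1 g) (hd : ContDiff ℝ 1 d)
    {a b δ : ℝ} (hδ : 0 < δ) (hdδ : ∀ t ∈ Icc a b, δ ≤ d t) :
    ∃ C : ℝ, ∀ s ∈ Icc a b, ∀ t ∈ Icc a b,
      |Real.arctan (√(g s) / d s) - Real.arctan (√(g t) / d t)| ≤ C * √|s - t| := by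
  obtain ⟨L, hL0, hL⟩ := hg.exists_abs_sub_le_on_Icc a b
  obtain ⟨L', hL'0, hL'⟩ := hd.exists_abs_sub_le_on_Icc a b
  obtain ⟨N, hN⟩ := (isCompact_Icc (a := a) (b := b)).exists_bound_of_continuousOn
    (f := fun t => √(g t)) (by have := hg.continuous; fun_prop)
  -- The first summand comes from varying the numerator `√g`, the second from varying `d`, whose
  -- Lipschitz bound is weakened by `|s - t| ≤ √|b - a| √|s - t|`.
  refine ⟨√L / δ + N * (L' * √|b - a|) / δ ^ 2, fun s hs t ht => ?_⟩
  refine (abs_arctan_sub_arctan_le _ _).trans ?_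
  have ds := hδ.trans_le (hdδ s hs)
  have dt := hδ.trans_le (hdδ t ht)
  have hN0 : 0 ≤ N := (norm_nonneg _).trans (hN s hs)
  have e : √(g s) / d s - √(g t) / d t =
      (√(g s) - √(g t)) / d s + √(g t) * (d t - d s) / (d s * d t) := by
    field_simp
    ring
  have hst : |s - t| ≤ √|b - a| * √|s - t| := by
    have h1 : |s - t| ≤ |b - a| := by
      rw [abs_of_nonneg (show 0 ≤ b - a by linarith [hs.1, hs.2]), abs_le]
      constructor <;> linarith [hs.1, hs.2, ht.1, ht.2]
    calc |s - t| = √|s - t| * √|s - t| := (Real.mul_self_sqrt (abs_nonneg _)).symm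
      _ ≤ _ := by gcongr
  have b1 : |(√(g s) - √(g t)) / d s| ≤ √L * √|s - t| / δ := by
    rw [abs_div, abs_of_pos ds]
    have : |√(g s) - √(g t)| ≤ √L * √|s - t| := by
      rw [← Real.sqrt_mul hL0]
      exact (abs_sqrt_sub_sqrt_le _ _).trans (Real.sqrt_le_sqrt (hL s hs t ht))
    gcongr
    exact hdδ s hs
  have b2 : |√(g t) * (d t - d s) / (d s * d t)| ≤ N * (L' * (√|b - a| * √|s - t|)) / δ ^ 2 := by
    rw [abs_div, abs_mul, abs_of_pos (mul_pos ds dt), sq]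
    have h1 : |√(g t)| ≤ N := hN t ht
    have h2 : |d t - d s| ≤ L' * (√|b - a| * √|s - t|) := by
      rw [abs_sub_comm]
      exact (hL' s hs t ht).trans (by gcongr)
    gcongr
    · exact hdδ s hs
    · exact hdδ t ht
  rw [e]
  refine (abs_add_le _ _).trans ((add_le_add b1 b2).trans_eq ?_)
  ring

namespace RWParams

variable {p : RWParams}

/-- `Θ₁`, extended by its (zero) boundary values outside `[y₁, y₂]`. -/
noncomputable def thetaExt (p : RWParams) (ξ : ℝ) : ℝ := p.Theta₁ (max p.y₁ (min p.y₂ ξ))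

theorem thetaExt_of_mem {ξ : ℝ} (hξ : ξ ∈ Icc p.y₁ p.y₂) : p.thetaExt ξ = p.Theta₁ ξ := by
  rw [thetaExt, min_eq_right hξ.2, max_eq_right hξ.1]

theorem thetaExt_of_notMem (h : p.Pos) (hs : p.Stable) {ξ : ℝ} (hξ : ξ ∉ Ioo p.y₁ p.y₂) :
    p.thetaExt ξ = 0 := by
  have h12 := (branch_order h hs.ne).2.1
  rw [mem_Ioo, not_and_or, not_lt, not_lt] at hξ
  unfold thetaExt
  rcases hξ with hξ | hξ
  · rw [max_eq_left ((min_le_right _ _).trans hξ), Theta₁_y₁ h hs]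
  · rw [min_eq_left hξ, max_eq_right h12.le, Theta₁_y₂ h hs]

theorem exists_sqrt_modulus_thetaExt (h : p.Pos) (hs : p.Stable) :
    ∃ C, ∀ s t, |p.thetaExt s - p.thetaExt t| ≤ C * √|s - t| := by
  have h12 := (branch_order h hs.ne).2.1
  obtain ⟨C, hC⟩ := exists_sqrt_modulus_arctan (g := fun y => -p.Delta₁real y)
    (d := fun y => p.m₂ * y ^ 2 - p.S * y + 2 * p.lam₁ + p.lam₂) (a := p.y₁) (b := p.y₂)
    (by unfold Delta₁real Breal; fun_prop) (by fun_prop) (two_lam_sub_pos h hs)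
    (fun t ht => Theta₁_denom_ge h hs ht)
  have hmem : ∀ s, max p.y₁ (min p.y₂ s) ∈ Icc p.y₁ p.y₂ := fun s =>
    ⟨le_max_left _ _, max_le h12.le (min_le_left _ _)⟩
  -- Clamping to the cut is 1-Lipschitz, so it preserves the modulus; the sign of `C` is not known.
  refine ⟨|C|, fun s t => (hC _ (hmem s) _ (hmem t)).trans ?_⟩
  have h1 : |max p.y₁ (min p.y₂ s) - max p.y₁ (min p.y₂ t)| ≤ |s - t| :=
    abs_projIcc_sub_projIcc h12.le
  gcongr
  exact le_abs_self C

theorem continuous_thetaExt (h : p.Pos) (hs : p.Stable) : Continuous p.thetaExt :=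
  continuous_of_sqrt_modulus (exists_sqrt_modulus_thetaExt h hs).choose_spec

theorem continuousOn_Theta₁ (h : p.Pos) (hs : p.Stable) :
    ContinuousOn p.Theta₁ (Icc p.y₁ p.y₂) :=
  (continuous_thetaExt h hs).continuousOn.congr fun _ hξ => (thetaExt_of_mem hξ).symm

/-! ### Zeros of the kernel on the circle -/

theorem K_ofReal_right (p : RWParams) (x : ℂ) {y : ℝ} (hy : y ≠ 0) :
    p.K x y = y * (p.m₁ * x ^ 2 - p.kernelTrace y * x + p.lam₁) := by
  have e : ((p.kernelTrace y * y : ℝ) : ℂ) = ((-p.Breal y : ℝ) : ℂ) :=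
    congrArg _ (kernelTrace_mul (p := p) hy)
  unfold Breal at e
  push_cast at e
  unfold K
  linear_combination x * e

theorem norm_eq_r₁_iff (h : p.Pos) {x : ℂ} :
    ‖x‖ = p.r₁ ↔ p.m₁ * (x.re ^ 2 + x.im ^ 2) = p.lam₁ := by
  have hm := h.m₁.ne'
  have e : x.re ^ 2 + x.im ^ 2 = ‖x‖ ^ 2 := by
    rw [← Complex.normSq_eq_norm_sq, Complex.normSq_apply]; ring
  rw [e, ← sq_eq_sq₀ (norm_nonneg x) h.r₁_pos.le, h.r₁_sq, eq_div_iff hm, mul_comm]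

theorem norm_lt_r₁_iff (h : p.Pos) {x : ℂ} :
    ‖x‖ < p.r₁ ↔ p.m₁ * (x.re ^ 2 + x.im ^ 2) < p.lam₁ := by
  have e : x.re ^ 2 + x.im ^ 2 = ‖x‖ ^ 2 := by
    rw [← Complex.normSq_eq_norm_sq, Complex.normSq_apply]; ring
  rw [e, ← sq_lt_sq₀ (norm_nonneg x) h.r₁_pos.le, h.r₁_sq, lt_div_iff₀ h.m₁, mul_comm]

/-- With a nonpositive discriminant the roots are conjugate, possibly equal, and their product is
`λ₁/m₁ = r₁²`. -/
theorem norm_eq_of_quadratic (h : p.Pos) {x : ℂ} {t : ℝ} (ht : t ^ 2 ≤ 4 * (p.m₁ * p.lam₁))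
    (hx : p.m₁ * x ^ 2 - t * x + p.lam₁ = 0) : ‖x‖ = p.r₁ := by
  rw [norm_eq_r₁_iff h]
  have hm := h.m₁
  have hre := congrArg Complex.re hx
  have him := congrArg Complex.im hx
  simp [pow_two] at hre him
  rcases eq_or_ne x.im 0 with h0 | h0
  · rw [h0] at hre ⊢
    have e : 2 * p.m₁ * x.re - t = 0 := by
      apply pow_eq_zero_iff two_ne_zero |>.1
      apply le_antisymm _ (sq_nonneg _)
      nlinarith
    linear_combination -hre + x.re * e
  · have e : 2 * p.m₁ * x.re = t := by
      apply mul_right_cancel₀ h0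
      linarith
    linear_combination -hre + x.re * e

theorem norm_eq_of_K_eq_zero (h : p.Pos) (hs : p.Stable) {x : ℂ} {y : ℝ}
    (hy : y ∈ Icc p.y₁ p.y₂) (hK : p.K x y = 0) : ‖x‖ = p.r₁ := by
  have h0 := pos_of_mem h hs hy
  rw [K_ofReal_right p x h0.ne'] at hK
  exact norm_eq_of_quadratic h (kernelTrace_sq_le h hs hy)
    ((mul_eq_zero.1 hK).resolve_left (by exact_mod_cast h0.ne'))

/-- The zero of `K(·, y)` on the lower half of the circle. -/
noncomputable def lowerPoint (p : RWParams) (y : ℝ) : ℂ :=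
  (p.kernelTrace y - √(4 * (p.m₁ * p.lam₁) - p.kernelTrace y ^ 2) * Complex.I) / (2 * p.m₁)

theorem lowerPoint_re (h : p.Pos) (y : ℝ) :
    2 * p.m₁ * (p.lowerPoint y).re = p.kernelTrace y := by
  have hm := h.m₁.ne'
  have e : (2 * p.m₁ : ℂ) = ((2 * p.m₁ : ℝ) : ℂ) := by push_cast; rfl
  rw [lowerPoint, e, Complex.div_ofReal_re]
  simp
  field_simp

theorem lowerPoint_im (h : p.Pos) (y : ℝ) :
    2 * p.m₁ * (p.lowerPoint y).im = -√(4 * (p.m₁ * p.lam₁) - p.kernelTrace y ^ 2) := by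
  have hm := h.m₁.ne'
  have e : (2 * p.m₁ : ℂ) = ((2 * p.m₁ : ℝ) : ℂ) := by push_cast; rfl
  rw [lowerPoint, e, Complex.div_ofReal_im]
  simp
  field_simp

theorem lowerPoint_quadratic (h : p.Pos) (hs : p.Stable) {y : ℝ} (hy : y ∈ Icc p.y₁ p.y₂) :
    p.m₁ * p.lowerPoint y ^ 2 - p.kernelTrace y * p.lowerPoint y + p.lam₁ = 0 := by
  have hm : (p.m₁ : ℂ) ≠ 0 := by exact_mod_cast h.m₁.ne'
  have hw := Real.sq_sqrt (sub_nonneg.2 (kernelTrace_sq_le h hs hy))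
  have hw' : (√(4 * (p.m₁ * p.lam₁) - p.kernelTrace y ^ 2) : ℂ) ^ 2 =
      4 * (p.m₁ * p.lam₁) - p.kernelTrace y ^ 2 := by exact_mod_cast hw
  unfold lowerPoint
  generalize ((√(4 * (p.m₁ * p.lam₁) - p.kernelTrace y ^ 2) : ℝ) : ℂ) = w at hw'
  field_simp
  linear_combination (-1 : ℂ) * hw' + w ^ 2 * Complex.I_sq

theorem norm_lowerPoint (h : p.Pos) (hs : p.Stable) {y : ℝ} (hy : y ∈ Icc p.y₁ p.y₂) :
    ‖p.lowerPoint y‖ = p.r₁ :=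
  norm_eq_of_quadratic h (kernelTrace_sq_le h hs hy) (lowerPoint_quadratic h hs hy)

/-- Every point of the circle is the lower point, or the conjugate of the lower point, over some
`y` in the cut. -/
theorem exists_lowerPoint (h : p.Pos) (hs : p.Stable) {x : ℂ} (hx : ‖x‖ = p.r₁) :
    ∃ y ∈ Icc p.y₁ p.y₂, x = p.lowerPoint y ∨ x = (starRingEnd ℂ) (p.lowerPoint y) := by
  have hm := h.m₁
  rw [norm_eq_r₁_iff h] at hx
  -- On the circle `λ₁/x = m₁ x̄`, so `m₁x + λ₁/x = 2m₁ Re x` is the value that `t(y)` has to take.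
  obtain ⟨y, hy, e⟩ := exists_kernelTrace_eq h hs (t := 2 * p.m₁ * x.re) (by
    nlinarith [mul_nonneg (sq_nonneg p.m₁) (sq_nonneg x.im)])
  refine ⟨y, hy, ?_⟩
  have hre : x.re = (p.lowerPoint y).re := by
    have := lowerPoint_re h y
    rw [e] at this
    exact (mul_left_cancel₀ (by positivity) this).symm
  have hn := (norm_eq_r₁_iff h).1 (norm_lowerPoint h hs hy)
  have him : x.im ^ 2 = (p.lowerPoint y).im ^ 2 := by
    apply mul_left_cancel₀ hm.ne'
    rw [hre] at hx
    linarith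
  rcases sq_eq_sq_iff_eq_or_eq_neg.1 him with h1 | h1
  · exact Or.inl (Complex.ext hre h1)
  · exact Or.inr (Complex.ext (by simpa using hre) (by simpa using h1))

theorem m₁_mul_mul_conj (h : p.Pos) {x : ℂ} (hx : ‖x‖ = p.r₁) :
    p.m₁ * (x * (starRingEnd ℂ) x) = p.lam₁ := by
  have := (norm_eq_r₁_iff h).1 hx
  rw [Complex.mul_conj, Complex.normSq_apply]
  rw [← this]
  push_cast
  ring

theorem ne_zero_of_norm (h : p.Pos) {x : ℂ} (hx : ‖x‖ = p.r₁) : x ≠ 0 := by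
  rw [← norm_pos_iff, hx]
  exact h.r₁_pos

/-! ### The root `Y₀` near the circle -/

theorem swap_B_eq (p : RWParams) {x : ℂ} {y : ℝ} (hy : y ≠ 0)
    (hx : p.m₁ * x ^ 2 - p.kernelTrace y * x + p.lam₁ = 0) :
    p.swap.B x * y = -(p.m₂ * y ^ 2 + p.lam₂) * x := by
  have e : ((p.kernelTrace y * y : ℝ) : ℂ) = ((-p.Breal y : ℝ) : ℂ) :=
    congrArg _ (kernelTrace_mul (p := p) hy)
  unfold Breal S at e
  push_cast at e
  simp only [B, S, RWParams.m₁, RWParams.m₂, RWParams.swap] at e hx ⊢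
  push_cast at e hx ⊢
  linear_combination (y : ℂ) * hx + x * e

/-- The roots of `K(x,·)` are `y` and `λ₂/(m₂y)`, both real, so the ratio under the root in `Y₀` is
the square of their difference over their sum. -/
theorem swap_ratio_eq (h : p.Pos) {x : ℂ} {y : ℝ} (hx0 : x ≠ 0) (hy : 0 < y)
    (hx : p.m₁ * x ^ 2 - p.kernelTrace y * x + p.lam₁ = 0) :
    p.swap.Delta₁ x / p.swap.B x ^ 2 =
      (((p.lam₂ - p.m₂ * y ^ 2) / (p.m₂ * y ^ 2 + p.lam₂)) ^ 2 : ℝ) := by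
  have hyc : (y : ℂ) ≠ 0 := by exact_mod_cast hy.ne'
  have hd : 0 < p.m₂ * y ^ 2 + p.lam₂ := by have := h.m₂; have := h.lam₂; positivity
  have hdc : (p.m₂ * y ^ 2 + p.lam₂ : ℂ) ≠ 0 := by exact_mod_cast hd.ne'
  have e : p.swap.B x = -(p.m₂ * y ^ 2 + p.lam₂) * x / y := by
    rw [eq_div_iff hyc, swap_B_eq p hy.ne' hx]
  have e2 : p.swap.Delta₁ x = p.swap.B x ^ 2 - 4 * p.m₂ * p.lam₂ * x ^ 2 := rfl
  rw [e2, e]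
  push_cast
  field_simp
  ring

theorem cpow_half_ofReal_sq {s : ℝ} (hs : 0 ≤ s) : (((s ^ 2 : ℝ) : ℂ)) ^ (1 / 2 : ℂ) = s := by
  have : ((s ^ 2 : ℝ) : ℂ) ^ ((1 / 2 : ℝ) : ℂ) = s := by
    rw [← Complex.ofReal_cpow (by positivity), ← Real.sqrt_eq_rpow, Real.sqrt_sq hs]
  simpa using this

theorem lam₂_sub_pos (h : p.Pos) (hs : p.Stable) {y : ℝ} (hy : y ∈ Icc p.y₁ p.y₂) :
    0 < p.lam₂ - p.m₂ * y ^ 2 := by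
  have := m₂_mul_mul_lt h hs hy hy
  rw [sq, ← mul_assoc]
  linarith

/-- As `λ₂ - m₂y² > 0` on the cut, the principal square root selects `y` and not `λ₂/(m₂y)`. -/
theorem Y₀_eq (h : p.Pos) (hs : p.Stable) {x : ℂ} {y : ℝ} (hx0 : x ≠ 0)
    (hy : y ∈ Icc p.y₁ p.y₂) (hx : p.m₁ * x ^ 2 - p.kernelTrace y * x + p.lam₁ = 0) :
    p.Y₀ x = y := by
  have h0 := pos_of_mem h hs hy
  have h1 := lam₂_sub_pos h hs hy
  have hm := h.m₂
  have hd : 0 < p.m₂ * y ^ 2 + p.lam₂ := by have := h.lam₂; positivity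
  have hyc : (y : ℂ) ≠ 0 := by exact_mod_cast h0.ne'
  have hmc : (p.m₂ : ℂ) ≠ 0 := by exact_mod_cast hm.ne'
  have hdc : (p.m₂ * y ^ 2 + p.lam₂ : ℂ) ≠ 0 := by exact_mod_cast hd.ne'
  have e : p.swap.B x = -(p.m₂ * y ^ 2 + p.lam₂) * x / y := by
    rw [eq_div_iff hyc, swap_B_eq p h0.ne' hx]
  have e2 : p.Y₀ x = (-p.swap.B x +
      p.swap.B x * (p.swap.Delta₁ x / p.swap.B x ^ 2) ^ (1 / 2 : ℂ)) / (2 * p.m₂ * x) := rfl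
  rw [e2, swap_ratio_eq h hx0 h0 hx, cpow_half_ofReal_sq (div_nonneg h1.le hd.le), e]
  push_cast
  field_simp
  ring

theorem swap_B_ne_zero (h : p.Pos) {x : ℂ} {y : ℝ} (hx0 : x ≠ 0) (hy : 0 < y)
    (hx : p.m₁ * x ^ 2 - p.kernelTrace y * x + p.lam₁ = 0) : p.swap.B x ≠ 0 := by
  intro h0
  have e := swap_B_eq p hy.ne' hx
  have hd : 0 < p.m₂ * y ^ 2 + p.lam₂ := by have := h.m₂; have := h.lam₂; positivity
  have hdc : (p.m₂ * y ^ 2 + p.lam₂ : ℂ) ≠ 0 := by exact_mod_cast hd.ne'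
  rw [h0, zero_mul] at e
  exact mul_ne_zero (neg_ne_zero.2 hdc) hx0 e.symm

theorem continuousAt_Y₀ (h : p.Pos) (hs : p.Stable) {x : ℂ} {y : ℝ} (hx0 : x ≠ 0)
    (hy : y ∈ Icc p.y₁ p.y₂) (hx : p.m₁ * x ^ 2 - p.kernelTrace y * x + p.lam₁ = 0) :
    ContinuousAt p.Y₀ x := by
  have h0 := pos_of_mem h hs hy
  have hB := swap_B_ne_zero h hx0 h0 hx
  have h1 := lam₂_sub_pos h hs hy
  have hd : 0 < p.m₂ * y ^ 2 + p.lam₂ := by have := h.m₂; have := h.lam₂; positivity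
  have cB : ContinuousAt p.swap.B x := by unfold B; fun_prop
  have cD : ContinuousAt p.swap.Delta₁ x := by unfold Delta₁ B; fun_prop
  have hsl : p.swap.Delta₁ x / p.swap.B x ^ 2 ∈ Complex.slitPlane := by
    rw [swap_ratio_eq h hx0 h0 hx, Complex.ofReal_mem_slitPlane]
    positivity
  have cS : ContinuousAt p.swap.sigma₁ x :=
    cB.mul ((cD.div (cB.pow 2) (pow_ne_zero 2 hB)).cpow continuousAt_const hsl)
  have hmc : (p.swap.m₁ : ℂ) ≠ 0 := by exact_mod_cast h.swap.m₁.ne'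
  exact (cB.neg.add cS).div (by fun_prop) (mul_ne_zero (mul_ne_zero two_ne_zero hmc) hx0)

theorem K_Y₀ (h : p.Pos) {x : ℂ} (hx0 : x ≠ 0) (hB : p.swap.B x ≠ 0) : p.K x (p.Y₀ x) = 0 := by
  have hmc : (p.swap.m₁ : ℂ) ≠ 0 := by exact_mod_cast h.swap.m₁.ne'
  have e1 := sigma₁_sq hB
  have e2 : 2 * p.swap.m₁ * x * p.Y₀ x = -p.swap.B x + p.swap.sigma₁ x := by
    unfold Y₀ X₀
    field_simp
  have e3 : p.swap.K (p.Y₀ x) x = p.swap.m₁ * x * p.Y₀ x ^ 2 + p.swap.B x * p.Y₀ x +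
      p.swap.lam₁ * x := by
    unfold K B; ring
  rw [← K_swap, e3]
  have hc : (4 * p.swap.m₁ * x : ℂ) ≠ 0 := mul_ne_zero (mul_ne_zero (by norm_num) hmc) hx0
  apply mul_left_cancel₀ hc
  unfold Delta₁ at e1
  linear_combination (2 * p.swap.m₁ * x * p.Y₀ x + p.swap.B x + p.swap.sigma₁ x) * e2 + e1

/-- For a zero `(x, η)` of the kernel, `Im x < 0` and `Im η > 0` go together when
`|x| < r₁` and `m₂ |η|² < λ₂`. -/
theorem im_pos_of_K_eq_zero (h : p.Pos) {x η : ℂ} (hx0 : x ≠ 0) (hη0 : η ≠ 0)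
    (hK : p.K x η = 0) (hx : ‖x‖ < p.r₁) (hη : p.m₂ * (η.re ^ 2 + η.im ^ 2) < p.lam₂)
    (him : x.im < 0) : 0 < η.im := by
  rw [norm_lt_r₁_iff h] at hx
  have e : p.m₁ * x + p.lam₁ / x + (p.m₂ * η + p.lam₂ / η) - p.S = 0 := by
    have : (x * η) * (p.m₁ * x + p.lam₁ / x + (p.m₂ * η + p.lam₂ / η) - p.S) = 0 := by
      rw [← hK]
      unfold K
      field_simp
      ring
    exact (mul_eq_zero.1 this).resolve_left (mul_ne_zero hx0 hη0)
  have hX : 0 < x.re ^ 2 + x.im ^ 2 := by nlinarith [sq_nonneg x.re]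
  have hN : 0 < η.re ^ 2 + η.im ^ 2 := by
    have := Complex.normSq_pos.2 hη0
    rw [Complex.normSq_apply] at this
    nlinarith
  have e2 := congrArg Complex.im e
  simp [Complex.div_im, Complex.normSq_apply] at e2
  rw [← sq, ← sq, ← sq, ← sq] at e2
  -- This is the imaginary part of `m₁x + λ₁/x = S - m₂η - λ₂/η`; the norm bounds fix the sign of
  -- each bracket.
  have e3 : x.im * (p.m₁ * (x.re ^ 2 + x.im ^ 2) - p.lam₁) / (x.re ^ 2 + x.im ^ 2) =
      η.im * (p.lam₂ - p.m₂ * (η.re ^ 2 + η.im ^ 2)) / (η.re ^ 2 + η.im ^ 2) := by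
    field_simp at e2 ⊢
    linarith
  have p1 : 0 < x.im * (p.m₁ * (x.re ^ 2 + x.im ^ 2) - p.lam₁) / (x.re ^ 2 + x.im ^ 2) :=
    div_pos (mul_pos_of_neg_of_neg him (by linarith)) hX
  rw [e3, div_pos_iff_of_pos_right hN] at p1
  exact pos_of_mul_pos_left p1 (by linarith)

/-! ### The coefficient `α₁` on the circle -/

theorem exp_I_mul_arctan (u : ℝ) :
    Complex.exp (Complex.I * Real.arctan u) = (1 + u * Complex.I) / (√(1 + u ^ 2) : ℝ) := by
  rw [mul_comm, Complex.exp_mul_I, ← Complex.ofReal_cos, ← Complex.ofReal_sin, Real.cos_arctan,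
    Real.sin_arctan]
  push_cast
  ring

theorem exp_neg_I_mul_arctan (u : ℝ) :
    Complex.exp (-Complex.I * Real.arctan u) = (1 - u * Complex.I) / (√(1 + u ^ 2) : ℝ) := by
  have := exp_I_mul_arctan (-u)
  rw [Real.arctan_neg] at this
  push_cast at this ⊢
  rw [neg_mul, ← mul_neg, this]
  ring_nf

theorem alpha₁_eq (h : p.Pos) (hs : p.Stable) {x : ℂ} (hx : ‖x‖ = p.r₁) {y : ℝ}
    (hy : y ∈ Icc p.y₁ p.y₂) (hq : p.m₁ * x ^ 2 - p.kernelTrace y * x + p.lam₁ = 0) :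
    p.alpha₁ x = (p.m₁ * (starRingEnd ℂ) x * y - p.lam₁) / (p.m₁ * x * y - p.lam₁) := by
  have hm : (p.m₁ : ℂ) ≠ 0 := by exact_mod_cast h.m₁.ne'
  rw [alpha₁, Y₀_eq h hs (ne_zero_of_norm h hx) hy hq, ← m₁_mul_mul_conj h hx,
    ← mul_div_mul_left _ _ hm]
  congr 1 <;> ring

theorem conj_quadratic {x : ℂ} {t : ℝ} (hx : p.m₁ * x ^ 2 - t * x + p.lam₁ = 0) :
    p.m₁ * (starRingEnd ℂ) x ^ 2 - t * (starRingEnd ℂ) x + p.lam₁ = 0 := by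
  have := congrArg (starRingEnd ℂ) hx
  simpa using this

/-- This is where `Θ₁` comes from: up to the real factor `D = -(2λ₁ - t(y)y)/2`, it is the argument
of the denominator of `α₁` at the lower point, as rewritten in `alpha₁_eq`. -/
theorem m₁_mul_lowerPoint_mul (h : p.Pos) (hs : p.Stable) {y : ℝ} (hy : y ∈ Icc p.y₁ p.y₂) :
    ∃ D : ℝ, D ≠ 0 ∧ p.m₁ * p.lowerPoint y * y - p.lam₁ =
        D * (1 + Real.tan (p.Theta₁ y) * Complex.I) ∧
      p.m₁ * (starRingEnd ℂ) (p.lowerPoint y) * y - p.lam₁ =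
        D * (1 - Real.tan (p.Theta₁ y) * Complex.I) := by
  have h0 := pos_of_mem h hs hy
  have hD := (two_lam_sub_pos h hs).trans_le (Theta₁_denom_ge h hs hy)
  have hΘ : Real.tan (p.Theta₁ y) = y * √(4 * (p.m₁ * p.lam₁) - p.kernelTrace y ^ 2) /
      (2 * p.lam₁ - p.kernelTrace y * y) := by
    rw [Theta₁, Real.tan_arctan, sqrt_neg_Delta₁real_eq p h0, Theta₁_denom p h0.ne']
  rw [Theta₁_denom p h0.ne'] at hD
  have e1 := lowerPoint_re h y
  have e2 := lowerPoint_im h y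
  have hD0 := hD.ne'
  generalize √(4 * (p.m₁ * p.lam₁) - p.kernelTrace y ^ 2) = w at hΘ e2
  rw [eq_div_iff hD0] at hΘ
  generalize Real.tan (p.Theta₁ y) = u at hΘ ⊢
  refine ⟨-(2 * p.lam₁ - p.kernelTrace y * y) / 2, 
    div_ne_zero (neg_ne_zero.2 hD.ne') two_ne_zero, ?_, ?_⟩
  · apply Complex.ext
    · simp 
      norm_cast
      linear_combination (y / 2) * e1
    · simp 
      norm_cast
      linear_combination (y / 2) * e2 + (1 / 2) * hΘ
  · apply Complex.ext
    · simp 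
      norm_cast
      linear_combination (y / 2) * e1
    · simp 
      norm_cast
      linear_combination (y / 2) * e2 + (1 / 2) * hΘ

theorem one_add_ofReal_mul_I_ne_zero (u : ℝ) : (1 + u * Complex.I : ℂ) ≠ 0 := by
  intro h
  have := congrArg Complex.re h
  simp at this

theorem one_sub_ofReal_mul_I_ne_zero (u : ℝ) : (1 - u * Complex.I : ℂ) ≠ 0 := by
  intro h
  have := congrArg Complex.re h
  simp at this

theorem sqrt_one_add_sq_ne_zero (u : ℝ) : ((√(1 + u ^ 2) : ℝ) : ℂ) ≠ 0 := by
  have : 0 < 1 + u ^ 2 := by positivity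
  exact_mod_cast (Real.sqrt_pos.2 this).ne'

theorem Theta₁_eq_arctan_tan (p : RWParams) (y : ℝ) :
    p.Theta₁ y = Real.arctan (Real.tan (p.Theta₁ y)) := by
  rw [Theta₁, Real.tan_arctan]

theorem alpha₁_lowerPoint (h : p.Pos) (hs : p.Stable) {y : ℝ} (hy : y ∈ Icc p.y₁ p.y₂) :
    Complex.exp (-Complex.I * p.Theta₁ y) =
      p.alpha₁ (p.lowerPoint y) * Complex.exp (Complex.I * p.Theta₁ y) := by
  obtain ⟨D, hD, e1, e2⟩ := m₁_mul_lowerPoint_mul h hs hy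
  have hDc : (D : ℂ) ≠ 0 := by exact_mod_cast hD
  rw [alpha₁_eq h hs (norm_lowerPoint h hs hy) hy (lowerPoint_quadratic h hs hy), e1, e2]
  rw [Theta₁_eq_arctan_tan p y, exp_I_mul_arctan, exp_neg_I_mul_arctan, ← Theta₁_eq_arctan_tan]
  have := one_add_ofReal_mul_I_ne_zero (Real.tan (p.Theta₁ y))
  have := sqrt_one_add_sq_ne_zero (Real.tan (p.Theta₁ y))
  field_simp

theorem alpha₁_conj_lowerPoint (h : p.Pos) (hs : p.Stable) {y : ℝ} (hy : y ∈ Icc p.y₁ p.y₂) :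
    Complex.exp (Complex.I * p.Theta₁ y) =
      p.alpha₁ ((starRingEnd ℂ) (p.lowerPoint y)) * Complex.exp (-Complex.I * p.Theta₁ y) := by
  obtain ⟨D, hD, e1, e2⟩ := m₁_mul_lowerPoint_mul h hs hy
  have hDc : (D : ℂ) ≠ 0 := by exact_mod_cast hD
  rw [alpha₁_eq h hs (by rw [RCLike.norm_conj, norm_lowerPoint h hs hy]) hy
    (conj_quadratic (lowerPoint_quadratic h hs hy)), Complex.conj_conj, e1, e2]
  rw [Theta₁_eq_arctan_tan p y, exp_I_mul_arctan, exp_neg_I_mul_arctan, ← Theta₁_eq_arctan_tan]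
  have := one_sub_ofReal_mul_I_ne_zero (Real.tan (p.Theta₁ y))
  have := sqrt_one_add_sq_ne_zero (Real.tan (p.Theta₁ y))
  field_simp

end RWParams

/-! ### Square roots in the upper half-plane -/

theorem cpow_half_sq (z : ℂ) : (z ^ (1 / 2 : ℂ)) ^ 2 = z := by
  rw [← Complex.cpow_nat_mul]
  simp

theorem cpow_half_re_nonneg (z : ℂ) : 0 ≤ (z ^ (1 / 2 : ℂ)).re := by
  rw [one_div, Complex.cpow_inv_two_re]
  exact Real.sqrt_nonneg _

theorem cpow_half_re_pos {z : ℂ} (hz : z ∈ Complex.slitPlane) : 0 < (z ^ (1 / 2 : ℂ)).re := by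
  rw [one_div, Complex.cpow_inv_two_re]
  apply Real.sqrt_pos.2
  have h1 := Complex.abs_re_le_norm z
  have h2 := neg_abs_le z.re
  rcases Complex.mem_slitPlane_iff.1 hz with h | h
  · have := norm_nonneg z
    linarith
  · have := Complex.abs_re_lt_norm.2 h
    linarith

/-- Both sides have the same square; the sign is decided by principal roots having nonnegative real
part. -/
theorem mul_cpow_half_of_im_pos {t : ℂ} (ht : 0 < t.im) {Q : ℝ} (hQ : 0 ≤ Q) :
    t * ((t ^ 2 - Q) / t ^ 2) ^ (1 / 2 : ℂ) = Complex.I * (Q - t ^ 2) ^ (1 / 2 : ℂ) := by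
  have ht0 : t ≠ 0 := by rintro rfl; simp at ht
  have hsl : (Q : ℂ) - t ^ 2 ∈ Complex.slitPlane := by
    rw [Complex.mem_slitPlane_iff]
    by_cases h : t.re = 0
    · left
      simp [pow_two, h]
      nlinarith
    · right
      simp [pow_two]
      intro h0
      apply mul_ne_zero h ht.ne'
      linarith
  have hg := cpow_half_re_pos hsl
  have hg2 := cpow_half_sq ((Q : ℂ) - t ^ 2)
  have hs := cpow_half_re_nonneg ((t ^ 2 - Q) / t ^ 2)
  have hs2 := cpow_half_sq ((t ^ 2 - Q) / t ^ 2)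
  generalize ((Q : ℂ) - t ^ 2) ^ (1 / 2 : ℂ) = g at *
  generalize ((t ^ 2 - Q) / t ^ 2) ^ (1 / 2 : ℂ) = s at *
  have e : (t * s) ^ 2 = (Complex.I * g) ^ 2 := by
    rw [mul_pow, mul_pow, hs2, hg2, Complex.I_sq]
    field_simp
    ring
  rcases sq_eq_sq_iff_eq_or_eq_neg.1 e with h | h
  · exact h
  -- With the opposite sign, `Re g · Re s · |t|²` would equal `-Im t ((Re g)² + (Re t)²) < 0`,
  -- although both real parts are nonnegative.
  · exfalso
    have h1 := congrArg Complex.re h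
    have h2 := congrArg Complex.im h
    have h3 := congrArg Complex.im hg2
    simp [pow_two] at h1 h2 h3
    have e3 : g.re * g.im = -(t.re * t.im) := by linarith
    have hN : s.re * (t.re ^ 2 + t.im ^ 2) = g.im * t.re - g.re * t.im := by
      linear_combination t.re * h1 + t.im * h2
    have h5 : 0 ≤ g.re * (s.re * (t.re ^ 2 + t.im ^ 2)) := by positivity
    rw [hN] at h5
    have h6 : 0 < t.im * (g.re ^ 2 + t.re ^ 2) := by
      have := pow_pos hg 2
      positivity
    have h7 : g.re * (g.im * t.re - g.re * t.im) = -(t.im * (g.re ^ 2 + t.re ^ 2)) := by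
      linear_combination t.re * e3
    linarith

/-! ### The limit of `X₀` from above the cut. -/

namespace RWParams

variable {p : RWParams}

/-- The ratio under the root in `sigma₁` runs into the branch cut of the principal root as `η`
approaches `[y₁, y₂]`. The new radicand tends to `4m₁λ₁ - t(y)² ≥ 0`, so this form passes to the
limit. -/
theorem X₀_eq (h : p.Pos) {η : ℂ} (hη : η ≠ 0) (ht : 0 < (p.S - p.m₂ * η - p.lam₂ / η).im) :
    p.X₀ η = ((p.S - p.m₂ * η - p.lam₂ / η) -
      Complex.I * (4 * (p.m₁ * p.lam₁) - (p.S - p.m₂ * η - p.lam₂ / η) ^ 2) ^ (1 / 2 : ℂ)) /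
        (2 * p.m₁) := by
  have hQ : 0 ≤ 4 * (p.m₁ * p.lam₁) := by have := h.m₁; have := h.lam₁; positivity
  have e := mul_cpow_half_of_im_pos ht hQ
  push_cast at e
  rw [← e]
  have hB : p.B η = -(p.S - p.m₂ * η - p.lam₂ / η) * η := by
    unfold B
    field_simp
    ring
  have ht0 : (p.S - p.m₂ * η - p.lam₂ / η : ℂ) ≠ 0 := by
    intro h0
    rw [h0] at ht
    simp at ht
  have hr : p.Delta₁ η / p.B η ^ 2 =
      ((p.S - p.m₂ * η - p.lam₂ / η) ^ 2 - 4 * (p.m₁ * p.lam₁)) /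
        (p.S - p.m₂ * η - p.lam₂ / η) ^ 2 := by
    unfold Delta₁
    rw [hB]
    generalize (p.S - p.m₂ * η - p.lam₂ / η : ℂ) = t at ht0 ⊢
    field_simp
  unfold X₀ sigma₁
  rw [hr, hB]
  have hm : (p.m₁ : ℂ) ≠ 0 := by exact_mod_cast h.m₁.ne'
  generalize (p.S - p.m₂ * η - p.lam₂ / η : ℂ) = t at ht0 ⊢
  field_simp
  ring

theorem tendsto_X₀ (h : p.Pos) (hs : p.Stable) {y : ℝ} (hy : y ∈ Icc p.y₁ p.y₂) :
    Tendsto (fun ε : ℝ => p.X₀ (y + ε * Complex.I)) (𝓝[>] 0) (𝓝 (p.lowerPoint y)) := by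
  have h0 := pos_of_mem h hs hy
  have hyc : (y : ℂ) ≠ 0 := by exact_mod_cast h0.ne'
  have hw := kernelTrace_sq_le h hs hy
  have hm : (2 * p.m₁ : ℂ) ≠ 0 := mul_ne_zero two_ne_zero (by exact_mod_cast h.m₁.ne')
  set T : ℂ → ℂ := fun η => p.S - p.m₂ * η - p.lam₂ / η with hT
  have hTy : T y = p.kernelTrace y := by simp [hT, kernelTrace]
  have cT : ContinuousAt T y := by
    rw [hT]
    exact ContinuousAt.sub (by fun_prop) (continuousAt_const.div continuousAt_id hyc)
  have cP : ContinuousAt (fun η => (T η - Complex.I *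
      (4 * (p.m₁ * p.lam₁) - T η ^ 2) ^ (1 / 2 : ℂ)) / (2 * p.m₁)) y := by
    refine ContinuousAt.div_const (cT.sub (continuousAt_const.mul ?_)) _
    refine ContinuousAt.comp (g := fun z : ℂ => z ^ (1 / 2 : ℂ))
      (f := fun η => 4 * (p.m₁ * p.lam₁) - T η ^ 2) ?_ (continuousAt_const.sub (cT.pow 2))
    -- The radicand vanishes at the endpoints of the cut, where the square root is still continuous.
    refine Complex.continuousAt_cpow_const_of_re_pos (Or.inl ?_) (by norm_num)
    rw [hTy]
    have e : (4 * (p.m₁ * p.lam₁) - (p.kernelTrace y : ℂ) ^ 2) =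
      ((4 * (p.m₁ * p.lam₁) - p.kernelTrace y ^ 2 : ℝ) : ℂ) := by push_cast; ring
    rw [e, Complex.ofReal_re]
    linarith
  have hlim : (T y - Complex.I * (4 * (p.m₁ * p.lam₁) - T y ^ 2) ^ (1 / 2 : ℂ)) / (2 * p.m₁) =
      p.lowerPoint y := by
    have e : (4 * (p.m₁ * p.lam₁) - (p.kernelTrace y : ℂ) ^ 2) =
      ((√(4 * (p.m₁ * p.lam₁) - p.kernelTrace y ^ 2) ^ 2 : ℝ) : ℂ) := by
      rw [Real.sq_sqrt (by linarith)]; push_cast; ring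
    rw [hTy, e, cpow_half_ofReal_sq (Real.sqrt_nonneg _), lowerPoint, mul_comm Complex.I]
  have hη : Tendsto (fun ε : ℝ => (y + ε * Complex.I : ℂ)) (𝓝[>] 0) (𝓝 y) := by
    have : Continuous fun ε : ℝ => (y + ε * Complex.I : ℂ) := by fun_prop
    simpa using (this.tendsto 0).mono_left nhdsWithin_le_nhds
  have hsm : ∀ᶠ η : ℂ in 𝓝 (y : ℂ), p.m₂ * (η.re ^ 2 + η.im ^ 2) < p.lam₂ := by
    have hc : ContinuousAt (fun η : ℂ => p.m₂ * (η.re ^ 2 + η.im ^ 2)) (y : ℂ) :=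
      Continuous.continuousAt (by fun_prop)
    apply hc.eventually_lt_const
    have := lam₂_sub_pos h hs hy
    simp
    linarith
  rw [← hlim]
  refine (cP.tendsto.comp hη).congr' ?_
  filter_upwards [hη.eventually hsm, self_mem_nhdsWithin] with ε h1 h2
  have h2 : 0 < ε := h2
  have hne : (y + ε * Complex.I : ℂ) ≠ 0 := by
    intro hc
    have := congrArg Complex.re hc
    simp at this
    linarith
  refine (X₀_eq h hne ?_).symm
  simp [Complex.div_im, Complex.normSq_apply] at h1 ⊢
  have hN : 0 < y * y + ε * ε := by positivity
  have : p.lam₂ * ε / (y * y + ε * ε) - p.m₂ * ε =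
      ε * (p.lam₂ - p.m₂ * (y ^ 2 + ε ^ 2)) / (y * y + ε * ε) := by
    field_simp
  have hp : 0 < ε * (p.lam₂ - p.m₂ * (y ^ 2 + ε ^ 2)) / (y * y + ε * ε) :=
    div_pos (mul_pos h2 (by linarith)) hN
  linarith

end RWParams

/-! ### Integrals depending on a parameter. -/

/-- An integral of holomorphic functions, depending continuously on the variable of integration,
is holomorphic. -/
theorem differentiableOn_intervalIntegral {U : Set ℂ} (hU : IsOpen U) {a b : ℝ} (hab : a ≤ b)
    {G G' : ℂ → ℝ → ℂ} (hG : ContinuousOn (Function.uncurry G) (U ×ˢ Icc a b))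
    (hG' : ContinuousOn (Function.uncurry G') (U ×ˢ Icc a b))
    (hd : ∀ x ∈ U, ∀ ξ ∈ Icc a b, HasDerivAt (fun x => G x ξ) (G' x ξ) x) :
    DifferentiableOn ℂ (fun x => ∫ ξ in a..b, G x ξ) U := by
  intro x₀ hx₀
  have slice : ∀ {H : ℂ → ℝ → ℂ}, ContinuousOn (Function.uncurry H) (U ×ˢ Icc a b) →
      ∀ x ∈ U, ContinuousOn (H x) (Icc a b) := by
    intro H hH x hx
    exact hH.comp (f := fun ξ => (x, ξ)) (by fun_prop) fun ξ hξ => ⟨hx, hξ⟩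
  have meas : ∀ {H : ℂ → ℝ → ℂ}, ContinuousOn (Function.uncurry H) (U ×ˢ Icc a b) →
      ∀ x ∈ U, MeasureTheory.AEStronglyMeasurable (H x)
        (MeasureTheory.volume.restrict (uIoc a b)) := by
    intro H hH x hx
    rw [uIoc_of_le hab]
    exact ((slice hH x hx).mono Ioc_subset_Icc_self).aestronglyMeasurable measurableSet_Ioc
  -- A compact ball is needed so that a constant dominates `G'`.
  obtain ⟨δ, hδ, hball⟩ := Metric.nhds_basis_closedBall.mem_iff.1 (hU.mem_nhds hx₀)
  obtain ⟨C, hC⟩ := ((isCompact_closedBall x₀ δ).prod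
    (isCompact_Icc (a := a) (b := b))).exists_bound_of_continuousOn
      (hG'.mono (prod_mono hball le_rfl))
  have key := intervalIntegral.hasDerivAt_integral_of_dominated_loc_of_deriv_le
    (μ := MeasureTheory.volume) (a := a) (b := b) (F := G) (F' := G') (x₀ := x₀)
    (s := Metric.closedBall x₀ δ) (bound := fun _ => C) (Metric.closedBall_mem_nhds x₀ hδ)
    (by filter_upwards [hU.mem_nhds hx₀] with x hx using meas hG x hx)
    (by
      apply ContinuousOn.intervalIntegrable
      rw [uIcc_of_le hab]
      exact slice hG x₀ hx₀)
    (meas hG' x₀ hx₀)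
    (Eventually.of_forall fun ξ hξ x hx => by
      rw [uIoc_of_le hab] at hξ
      exact hC (x, ξ) ⟨hx, Ioc_subset_Icc_self hξ⟩)
    intervalIntegrable_const
    (Eventually.of_forall fun ξ hξ x hx => by
      rw [uIoc_of_le hab] at hξ
      exact hd x (hball hx) ξ (Ioc_subset_Icc_self hξ))
  exact key.2.differentiableAt.differentiableWithinAt

theorem tendsto_setIntegral_sdiff_Ioo {g : ℝ → ℝ} {a b : ℝ}
    (hg : MeasureTheory.IntegrableOn g (Icc a b)) (y : ℝ) :
    Tendsto (fun ε : ℝ => ∫ ξ in Icc a b \ Ioo (y - ε) (y + ε), g ξ) (𝓝[>] 0)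
      (𝓝 (∫ ξ in Icc a b, g ξ)) := by
  simp_rw [sdiff_eq, ← MeasureTheory.setIntegral_indicator measurableSet_Ioo.compl]
  apply MeasureTheory.tendsto_integral_filter_of_dominated_convergence (fun ξ => ‖g ξ‖)
  · exact Eventually.of_forall fun ε => hg.aestronglyMeasurable.indicator measurableSet_Ioo.compl
  · exact Eventually.of_forall fun ε => Eventually.of_forall fun ξ =>
      norm_indicator_le_norm_self _ _
  · exact hg.norm
  · filter_upwards [MeasureTheory.ae_restrict_of_ae
      (MeasureTheory.compl_mem_ae_iff.2 (MeasureTheory.measure_singleton y))] with ξ hξ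
    have hξ : 0 < |ξ - y| := abs_pos.2 (sub_ne_zero.2 hξ)
    refine tendsto_const_nhds.congr' ?_
    filter_upwards [nhdsWithin_le_nhds (gt_mem_nhds hξ)] with ε hε
    rw [indicator_of_mem]
    intro hc
    have : |ξ - y| < ε := abs_lt.2 ⟨by linarith [hc.1], by linarith [hc.2]⟩
    linarith

namespace RWParams

variable {p : RWParams}

/-! ### Symmetries and holomorphy of `φ₁` -/

theorem K_ne_zero (h : p.Pos) (hs : p.Stable) {x : ℂ} (hx : ‖x‖ ≠ p.r₁) {y : ℝ}
    (hy : y ∈ Icc p.y₁ p.y₂) : p.K x y ≠ 0 := fun hK => hx (norm_eq_of_K_eq_zero h hs hy hK)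

theorem phi₁_conj (p : RWParams) (x : ℂ) :
    p.phi₁ ((starRingEnd ℂ) x) = (starRingEnd ℂ) (p.phi₁ x) := by
  have e : (fun y : ℝ => (((p.lam₂ - p.m₂ * y ^ 2) * p.Theta₁ y : ℝ) : ℂ) /
      (y * p.K ((starRingEnd ℂ) x) y)) = fun y : ℝ => (starRingEnd ℂ)
        ((((p.lam₂ - p.m₂ * y ^ 2) * p.Theta₁ y : ℝ) : ℂ) / (y * p.K x y)) := by
    funext y
    simp [K]
  unfold phi₁
  rw [e, ← Complex.exp_conj, map_mul, map_div₀, Complex.conj_ofReal,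
    intervalIntegral.intervalIntegral_eq_integral_uIoc,
    intervalIntegral.intervalIntegral_eq_integral_uIoc, Complex.real_smul,
    Complex.real_smul, map_mul, Complex.conj_ofReal, integral_conj]

/-- The kernel up to the factor `x` is invariant under `x ↦ r₁² / x`. -/
theorem mul_K_eq {x x' : ℂ} (hxx : p.m₁ * (x * x') = p.lam₁) (y : ℂ) :
    x' * p.K x y = x * p.K x' y := by
  unfold K
  linear_combination (y * x - y * x') * hxx

/-- By `mul_K_eq` the factor `x / K(x,y)` of the exponent takes the same value at `x` and `x'`.
Where `K` vanishes, both quotients are zero by convention. -/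
theorem phi₁_eq_of_mul_eq {x x' : ℂ} (hx : x ≠ 0) (hx' : x' ≠ 0)
    (hxx : p.m₁ * (x * x') = p.lam₁) : p.phi₁ x' = p.phi₁ x := by
  unfold phi₁
  rw [div_mul_eq_mul_div, div_mul_eq_mul_div, ← intervalIntegral.integral_const_mul,
    ← intervalIntegral.integral_const_mul]
  congr 3
  ext y
  have e := mul_K_eq hxx y
  rcases eq_or_ne (p.K x y) 0 with h0 | h0
  · have h1 : p.K x' y = 0 := by
      rw [h0, mul_zero] at e
      exact (mul_eq_zero.1 e.symm).resolve_left hx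
    simp [h0, h1]
  · have h1 : p.K x' y ≠ 0 := by
      intro h1
      rw [h1, mul_zero] at e
      exact (mul_ne_zero hx' h0) e
    rcases eq_or_ne (y : ℂ) 0 with hy | hy
    · simp [hy]
    field_simp
    linear_combination (((p.lam₂ - p.m₂ * y ^ 2) * p.Theta₁ y : ℝ) : ℂ) * e

theorem phi₁_zero (p : RWParams) : p.phi₁ 0 = 1 := by simp [phi₁]

theorem phi₁_ne_zero (p : RWParams) (x : ℂ) : p.phi₁ x ≠ 0 := Complex.exp_ne_zero _

theorem continuousOn_density (h : p.Pos) (hs : p.Stable) (U : Set ℂ) :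
    ContinuousOn (fun q : ℂ × ℝ => (((p.lam₂ - p.m₂ * q.2 ^ 2) * p.Theta₁ q.2 : ℝ) : ℂ))
      (U ×ˢ Icc p.y₁ p.y₂) := by
  have hΘ : ContinuousOn (fun q : ℂ × ℝ => p.Theta₁ q.2) (U ×ˢ Icc p.y₁ p.y₂) :=
    (continuousOn_Theta₁ h hs).comp (by fun_prop) fun q hq => hq.2
  exact Complex.continuous_ofReal.comp_continuousOn
    (ContinuousOn.mul (by fun_prop) hΘ)

theorem differentiableOn_phi₁ (h : p.Pos) (hs : p.Stable) :
    DifferentiableOn ℂ p.phi₁ {x | ‖x‖ ≠ p.r₁} := by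
  have hU : IsOpen {x : ℂ | ‖x‖ ≠ p.r₁} := isOpen_ne_fun continuous_norm continuous_const
  have h12 := (branch_order h hs.ne).2.1
  have hne : ∀ q ∈ {x : ℂ | ‖x‖ ≠ p.r₁} ×ˢ Icc p.y₁ p.y₂, (q.2 : ℂ) * p.K q.1 q.2 ≠ 0 :=
    fun q hq => mul_ne_zero (by exact_mod_cast (pos_of_mem h hs hq.2).ne')
      (K_ne_zero h hs hq.1 hq.2)
  have key : DifferentiableOn ℂ (fun x => ∫ y in p.y₁..p.y₂,
      ((p.lam₂ - p.m₂ * y ^ 2) * p.Theta₁ y : ℝ) / (y * p.K x y)) {x | ‖x‖ ≠ p.r₁} := by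
    apply differentiableOn_intervalIntegral hU h12.le
      (G' := fun x y => -(((p.lam₂ - p.m₂ * y ^ 2) * p.Theta₁ y : ℝ) : ℂ) *
        (y * (2 * p.m₁ * x * y + p.B y)) / (y * p.K x y) ^ 2)
    · refine ContinuousOn.div (continuousOn_density h hs _) ?_ hne
      unfold K
      fun_prop
    · refine ContinuousOn.div ((continuousOn_density h hs _).neg.mul ?_) ?_
        fun q hq => pow_ne_zero 2 (hne q hq)
      · unfold B
        fun_prop
      · unfold K
        fun_prop
    · intro x hx ξ hξ
      have hK : HasDerivAt (fun x => (ξ : ℂ) * p.K x ξ) (ξ * (2 * p.m₁ * x * ξ + p.B ξ)) x := by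
        have e : (fun x => (ξ : ℂ) * p.K x ξ) =
            fun x => (ξ : ℂ) * (p.m₁ * ξ * x ^ 2 + p.B ξ * x + p.lam₁ * ξ) := by
          ext x
          unfold K B
          ring
        rw [e]
        have hd := (((hasDerivAt_pow 2 x).const_mul (p.m₁ * ξ : ℂ)).add
          ((hasDerivAt_id x).const_mul (p.B ξ))).add_const (p.lam₁ * ξ : ℂ)
        refine (hd.const_mul (ξ : ℂ)).congr_deriv ?_
        push_cast
        ring
      have hd := (hasDerivAt_const x
        ((((p.lam₂ - p.m₂ * ξ ^ 2) * p.Theta₁ ξ : ℝ) : ℂ))).div hK (hne (x, ξ) ⟨hx, hξ⟩)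
      refine hd.congr_deriv ?_
      ring
  unfold phi₁
  exact ((differentiableOn_id.div_const _).mul key).cexp

theorem analyticOnNhd_phi₁ (h : p.Pos) (hs : p.Stable) :
    AnalyticOnNhd ℂ p.phi₁ {x | ‖x‖ ≠ p.r₁} :=
  (differentiableOn_phi₁ h hs).analyticOnNhd (isOpen_ne_fun continuous_norm continuous_const)

theorem mem_Dint {x : ℂ} : x ∈ p.Dint ↔ ‖x‖ < p.r₁ := by simp [Dint]

theorem mem_Dext {x : ℂ} : x ∈ p.Dext ↔ p.r₁ < ‖x‖ := by simp [Dext]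

theorem phi₁_inversion (h : p.Pos) {x : ℂ} (hx : x ≠ 0) :
    p.phi₁ (p.lam₁ / (p.m₁ * x)) = p.phi₁ x := by
  have hm : (p.m₁ : ℂ) ≠ 0 := by exact_mod_cast h.m₁.ne'
  have hl : (p.lam₁ : ℂ) ≠ 0 := by exact_mod_cast h.lam₁.ne'
  apply phi₁_eq_of_mul_eq hx (div_ne_zero hl (mul_ne_zero hm hx))
  field_simp

/-- The inversion exchanges infinity with the origin, where `φ₁` is continuous with value 1. -/
theorem tendsto_phi₁_cobounded (h : p.Pos) (hs : p.Stable) :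
    Tendsto p.phi₁ (Bornology.cobounded ℂ) (𝓝 1) := by
  have hc : ContinuousAt p.phi₁ 0 :=
    (analyticOnNhd_phi₁ h hs 0 (by simpa using h.r₁_pos.ne)).continuousAt
  have h1 : Tendsto (fun x : ℂ => p.lam₁ / (p.m₁ * x)) (Bornology.cobounded ℂ) (𝓝 0) := by
    have := (tendsto_inv₀_cobounded (α := ℂ)).const_mul (p.lam₁ / p.m₁ : ℂ)
    rw [mul_zero] at this
    refine this.congr fun x => ?_
    field_simp
  have h2 := hc.tendsto.comp h1
  rw [phi₁_zero] at h2
  refine h2.congr' ?_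
  filter_upwards [Bornology.eventually_ne_cobounded (0 : ℂ)] with x hx
  exact phi₁_inversion h hx

/-- Exterior limits of `φ₁` are interior limits at the conjugate point. -/
theorem tendsto_phi₁_Dext (h : p.Pos) {x l : ℂ} (hx : ‖x‖ = p.r₁)
    (hl : Tendsto p.phi₁ (𝓝[p.Dint] ((starRingEnd ℂ) x)) (𝓝 l)) :
    Tendsto p.phi₁ (𝓝[p.Dext] x) (𝓝 l) := by
  have hx0 := ne_zero_of_norm h hx
  have hm : (p.m₁ : ℂ) ≠ 0 := by exact_mod_cast h.m₁.ne'
  have e : (p.lam₁ / (p.m₁ * x) : ℂ) = (starRingEnd ℂ) x := by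
    rw [← m₁_mul_mul_conj h hx]
    field_simp
  have h1 : Tendsto (fun z : ℂ => p.lam₁ / (p.m₁ * z)) (𝓝[p.Dext] x)
      (𝓝[p.Dint] ((starRingEnd ℂ) x)) := by
    apply tendsto_nhdsWithin_of_tendsto_nhds_of_eventually_within
    · rw [← e]
      have : ContinuousAt (fun z : ℂ => p.lam₁ / (p.m₁ * z)) x :=
        continuousAt_const.div (by fun_prop) (mul_ne_zero hm hx0)
      exact this.tendsto.mono_left nhdsWithin_le_nhds
    · filter_upwards [self_mem_nhdsWithin] with z hz
      rw [mem_Dext] at hz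
      have hr := h.r₁_pos
      rw [mem_Dint, norm_div, norm_mul, Complex.norm_real, Complex.norm_real,
        Real.norm_of_nonneg h.lam₁.le, Real.norm_of_nonneg h.m₁.le, ← div_div, ← h.r₁_sq,
        div_lt_iff₀ (hr.trans hz), sq]
      gcongr
  refine (hl.comp h1).congr' ?_
  filter_upwards [self_mem_nhdsWithin] with z hz
  rw [mem_Dext] at hz
  exact phi₁_inversion h (norm_pos_iff.1 (h.r₁_pos.trans hz))

theorem tendsto_phi₁_Dint_conj {x l : ℂ} (hl : Tendsto p.phi₁ (𝓝[p.Dint] x) (𝓝 l)) :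
    Tendsto p.phi₁ (𝓝[p.Dint] ((starRingEnd ℂ) x)) (𝓝 ((starRingEnd ℂ) l)) := by
  have h1 : Tendsto (starRingEnd ℂ) (𝓝[p.Dint] ((starRingEnd ℂ) x)) (𝓝[p.Dint] x) := by
    apply tendsto_nhdsWithin_of_tendsto_nhds_of_eventually_within
    · simpa using (Complex.continuous_conj.tendsto ((starRingEnd ℂ) x)).mono_left
        nhdsWithin_le_nhds
    · filter_upwards [self_mem_nhdsWithin] with z hz
      rw [mem_Dint] at hz ⊢
      rwa [RCLike.norm_conj]
  have h2 := (Complex.continuous_conj.tendsto l).comp (hl.comp h1)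
  refine h2.congr fun z => ?_
  simp only [Function.comp]
  rw [phi₁_conj, Complex.conj_conj]

/-! ### Boundary values of `φ₁` -/

/-- The part of the exponent of `φ₁` which is regular on the cut, in terms of a zero `η` of the
kernel. -/
noncomputable def regularPart (p : RWParams) (η : ℂ) : ℂ :=
  ∫ ξ in p.y₁..p.y₂, p.thetaExt ξ * (1 / ξ - p.m₂ * η / (p.m₂ * ξ * η - p.lam₂))

/-- The values of `regularPart` at real points. -/
noncomputable def regularPartReal (p : RWParams) (y : ℝ) : ℝ :=
  ∫ ξ in p.y₁..p.y₂, p.thetaExt ξ * (1 / ξ - p.m₂ * y / (p.m₂ * ξ * y - p.lam₂))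

theorem regularPart_ofReal (p : RWParams) (y : ℝ) :
    p.regularPart y = p.regularPartReal y := by
  unfold regularPart regularPartReal
  rw [← intervalIntegral.integral_ofReal]
  push_cast
  rfl

theorem regular_denom_ne_zero (h : p.Pos) (hs : p.Stable) {η : ℂ}
    (hη : p.m₂ * p.y₂ * ‖η‖ < p.lam₂) {ξ : ℝ} (hξ : ξ ∈ Icc p.y₁ p.y₂) :
    (p.m₂ * ξ * η - p.lam₂ : ℂ) ≠ 0 := by
  intro hc
  have h0 := pos_of_mem h hs hξ
  have e := congrArg norm (sub_eq_zero.1 hc)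
  rw [norm_mul, norm_mul, Complex.norm_real, Complex.norm_real, Complex.norm_real,
    Real.norm_of_nonneg h.m₂.le, Real.norm_of_nonneg h0.le, Real.norm_of_nonneg h.lam₂.le] at e
  have : p.m₂ * ξ * ‖η‖ ≤ p.m₂ * p.y₂ * ‖η‖ := by
    have := h.m₂
    gcongr
    exact hξ.2
  linarith

theorem continuousOn_thetaExt_prod (h : p.Pos) (hs : p.Stable) (U : Set (ℂ × ℝ)) :
    ContinuousOn (fun q : ℂ × ℝ => (p.thetaExt q.2 : ℂ)) U := by
  have := continuous_thetaExt h hs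
  fun_prop

theorem differentiableOn_regularPart (h : p.Pos) (hs : p.Stable) :
    DifferentiableOn ℂ p.regularPart {η | p.m₂ * p.y₂ * ‖η‖ < p.lam₂} := by
  have hU : IsOpen {η : ℂ | p.m₂ * p.y₂ * ‖η‖ < p.lam₂} :=
    isOpen_lt (by fun_prop) continuous_const
  have h12 := (branch_order h hs.ne).2.1
  have hne : ∀ q ∈ {η : ℂ | p.m₂ * p.y₂ * ‖η‖ < p.lam₂} ×ˢ Icc p.y₁ p.y₂,
      (p.m₂ * (q.2 : ℂ) * q.1 - p.lam₂ : ℂ) ≠ 0 :=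
    fun q hq => regular_denom_ne_zero h hs hq.1 hq.2
  apply differentiableOn_intervalIntegral hU h12.le
    (G' := fun η ξ => p.thetaExt ξ * (p.m₂ * p.lam₂ / (p.m₂ * ξ * η - p.lam₂) ^ 2))
  · refine (continuousOn_thetaExt_prod h hs _).mul (ContinuousOn.sub ?_ ?_)
    · exact continuousOn_const.div (by fun_prop) fun q hq => by
        exact_mod_cast (pos_of_mem h hs hq.2).ne'
    · exact ContinuousOn.div (by fun_prop) (by fun_prop) hne
  · refine (continuousOn_thetaExt_prod h hs _).mul ?_
    exact ContinuousOn.div (by fun_prop) (by fun_prop) fun q hq => pow_ne_zero 2 (hne q hq)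
  · intro η hη ξ hξ
    have h1 : HasDerivAt (fun η : ℂ => p.m₂ * η) (p.m₂ : ℂ) η := by
      simpa using (hasDerivAt_id η).const_mul (p.m₂ : ℂ)
    have h2 : HasDerivAt (fun η : ℂ => p.m₂ * ξ * η - p.lam₂) (p.m₂ * ξ : ℂ) η := by
      simpa using ((hasDerivAt_id η).const_mul (p.m₂ * ξ : ℂ)).sub_const (p.lam₂ : ℂ)
    refine (((h1.div h2 (hne (η, ξ) ⟨hη, hξ⟩)).const_sub (1 / ξ : ℂ)).const_mul
      (p.thetaExt ξ : ℂ)).congr_deriv ?_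
    ring

theorem regular_of_mem (h : p.Pos) (hs : p.Stable) {y : ℝ} (hy : y ∈ Icc p.y₁ p.y₂) :
    p.m₂ * p.y₂ * ‖(y : ℂ)‖ < p.lam₂ := by
  have h12 := (branch_order h hs.ne).2.1
  rw [Complex.norm_real, Real.norm_of_nonneg (pos_of_mem h hs hy).le]
  exact m₂_mul_mul_lt h hs ⟨h12.le, le_rfl⟩ hy

theorem continuousAt_regularPart (h : p.Pos) (hs : p.Stable) {y : ℝ}
    (hy : y ∈ Icc p.y₁ p.y₂) : ContinuousAt p.regularPart y :=
  ((differentiableOn_regularPart h hs).differentiableAt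
    ((isOpen_lt (by fun_prop) continuous_const).mem_nhds
      (regular_of_mem h hs hy))).continuousAt

/-- Vieta for `K(x,·)`: the root accompanying `η` is `λ₂/(m₂η)`. -/
theorem K_factor {x η ξ : ℂ} (hK : p.K x η = 0) :
    p.K x ξ * η = x * ((ξ - η) * (p.m₂ * ξ * η - p.lam₂)) := by
  unfold K at hK ⊢
  linear_combination ξ * hK

/-- `φ₁` as the exponential of a Cauchy integral over the cut. -/
theorem phi₁_eq_exp (h : p.Pos) (hs : p.Stable) {x η : ℂ} (hx : ‖x‖ ≠ p.r₁) (hx0 : x ≠ 0)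
    (hη0 : η ≠ 0) (hK : p.K x η = 0) (hη : p.m₂ * p.y₂ * ‖η‖ < p.lam₂) :
    p.phi₁ x = Complex.exp (1 / Real.pi *
      (-(∫ ξ in p.y₁..p.y₂, (p.thetaExt ξ : ℂ) / (ξ - η)) + p.regularPart η)) := by
  have h12 := (branch_order h hs.ne).2.1
  have hc := continuous_thetaExt h hs
  -- If `η` were on the cut, its partner `x` would be on the circle.
  have hsub : ∀ ξ ∈ Icc p.y₁ p.y₂, ((ξ : ℂ) - η) ≠ 0 := by
    intro ξ hξ h0
    rw [← sub_eq_zero.1 h0] at hK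
    exact K_ne_zero h hs hx hξ hK
  have i1 : IntervalIntegrable (fun ξ : ℝ => (p.thetaExt ξ : ℂ) / (ξ - η))
      MeasureTheory.volume p.y₁ p.y₂ := by
    apply ContinuousOn.intervalIntegrable
    rw [uIcc_of_le h12.le]
    exact ContinuousOn.div (by fun_prop) (by fun_prop) hsub
  have i2 : IntervalIntegrable (fun ξ : ℝ => (p.thetaExt ξ : ℂ) *
      (1 / ξ - p.m₂ * η / (p.m₂ * ξ * η - p.lam₂))) MeasureTheory.volume p.y₁ p.y₂ := by
    apply ContinuousOn.intervalIntegrable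
    rw [uIcc_of_le h12.le]
    refine ContinuousOn.mul (by fun_prop) (ContinuousOn.sub ?_ ?_)
    · exact continuousOn_const.div (by fun_prop) fun q hq => by
        exact_mod_cast (pos_of_mem h hs hq).ne'
    · exact ContinuousOn.div (by fun_prop) (by fun_prop)
        fun ξ hξ => regular_denom_ne_zero h hs hη hξ
  have i3 : IntervalIntegrable (fun ξ : ℝ => -((p.thetaExt ξ : ℂ) / (ξ - η)))
      MeasureTheory.volume p.y₁ p.y₂ := i1.neg
  unfold phi₁ regularPart
  rw [← intervalIntegral.integral_neg, ← intervalIntegral.integral_add i3 i2,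
    div_mul_eq_mul_div, div_mul_eq_mul_div, one_mul, ← intervalIntegral.integral_const_mul]
  congr 2
  apply intervalIntegral.integral_congr
  intro ξ hξ
  rw [uIcc_of_le h12.le] at hξ
  have a0 : (ξ : ℂ) ≠ 0 := by exact_mod_cast (pos_of_mem h hs hξ).ne'
  have a1 := hsub ξ hξ
  have a2 := regular_denom_ne_zero h hs hη hξ
  -- After this substitution the rational factor is `η(λ₂ - m₂ξ²) / (ξ(ξ-η)(m₂ξη-λ₂))`, with partial
  -- fractions `-1/(ξ-η) + 1/ξ - m₂η/(m₂ξη-λ₂)`.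
  have eK : p.K x ξ = x * ((ξ - η) * (p.m₂ * ξ * η - p.lam₂)) / η := by
    rw [eq_div_iff hη0, K_factor hK]
  simp only [eK, thetaExt_of_mem hξ]
  push_cast
  field_simp
  ring

/-- The principal value `π Φ₁(y)`. -/
noncomputable def pvValue (p : RWParams) (y : ℝ) : ℝ :=
  p.regularPartReal y - truncHilbert p.thetaExt (p.y₂ - p.y₁ + 1) y

/-- The partial fractions of `phi₁_eq_exp` at the real point `η = y` leave one singular term,
treated by `tendsto_truncated_cauchy`; the remainder is continuous on the cut. -/
theorem hasCauchyPV_PhiIntegrand (h : p.Pos) (hs : p.Stable) {y : ℝ}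
    (hy : y ∈ Icc p.y₁ p.y₂) :
    HasCauchyPV (p.PhiIntegrand y) p.y₁ p.y₂ y (p.pvValue y) := by
  have h12 := (branch_order h hs.ne).2.1
  have h0 := pos_of_mem h hs hy
  have hc := continuous_thetaExt h hs
  obtain ⟨C, hC⟩ := exists_sqrt_modulus_thetaExt h hs
  have hsub : ∀ ε > 0, ∀ ξ ∈ Icc p.y₁ p.y₂ \ Ioo (y - ε) (y + ε), ξ - y ≠ 0 := by
    rintro ε hε ξ hξ h0
    have : ξ = y := sub_eq_zero.1 h0
    exact hξ.2 ⟨by linarith, by linarith⟩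
  have hden : ∀ ξ ∈ Icc p.y₁ p.y₂, p.m₂ * ξ * y - p.lam₂ ≠ 0 := fun ξ hξ =>
    (sub_neg.2 (m₂_mul_mul_lt h hs hξ hy)).ne
  have hcomp : ∀ ε : ℝ, IsCompact (Icc p.y₁ p.y₂ \ Ioo (y - ε) (y + ε)) := fun ε =>
    isCompact_Icc.diff isOpen_Ioo
  have e : ∀ ε > 0, ∀ ξ ∈ Icc p.y₁ p.y₂ \ Ioo (y - ε) (y + ε), p.PhiIntegrand y ξ =
      -(p.thetaExt ξ / (ξ - y)) +
        p.thetaExt ξ * (1 / ξ - p.m₂ * y / (p.m₂ * ξ * y - p.lam₂)) := by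
    intro ε hε ξ hξ
    have a1 := hsub ε hε ξ hξ
    have a2 := hden ξ hξ.1
    have a3 := (pos_of_mem h hs hξ.1).ne'
    have a4 : p.m₂ * y * ξ - p.lam₂ = p.m₂ * ξ * y - p.lam₂ := by ring
    unfold PhiIntegrand
    rw [thetaExt_of_mem hξ.1, a4]
    generalize hd : p.m₂ * ξ * y - p.lam₂ = d at a2 ⊢
    field_simp
    linear_combination -y * p.Theta₁ ξ * hd
  have creg : ContinuousOn (fun ξ => p.thetaExt ξ *
      (1 / ξ - p.m₂ * y / (p.m₂ * ξ * y - p.lam₂))) (Icc p.y₁ p.y₂) := by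
    refine ContinuousOn.mul (by fun_prop) (ContinuousOn.sub ?_ ?_)
    · exact continuousOn_const.div (by fun_prop) fun q hq => (pos_of_mem h hs hq).ne'
    · exact ContinuousOn.div (by fun_prop) (by fun_prop) hden
  have i1 : ∀ ε > 0, MeasureTheory.IntegrableOn (fun ξ => -(p.thetaExt ξ / (ξ - y)))
      (Icc p.y₁ p.y₂ \ Ioo (y - ε) (y + ε)) := fun ε hε =>
    (ContinuousOn.div (by fun_prop) (by fun_prop) (hsub ε hε)).neg.integrableOn_compact (hcomp ε)
  have i2 : MeasureTheory.IntegrableOn (fun ξ => p.thetaExt ξ *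
      (1 / ξ - p.m₂ * y / (p.m₂ * ξ * y - p.lam₂))) (Icc p.y₁ p.y₂) :=
    creg.integrableOn_compact isCompact_Icc
  have i3 : ∀ ε : ℝ, MeasureTheory.IntegrableOn (fun ξ => p.thetaExt ξ *
      (1 / ξ - p.m₂ * y / (p.m₂ * ξ * y - p.lam₂))) (Icc p.y₁ p.y₂ \ Ioo (y - ε) (y + ε)) :=
    fun ε => i2.mono_set sdiff_subset
  have hms : ∀ ε : ℝ, MeasurableSet (Icc p.y₁ p.y₂ \ Ioo (y - ε) (y + ε)) := fun ε =>
    measurableSet_Icc.diff measurableSet_Ioo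
  refine ⟨fun ε hε => ((i1 ε hε).add (i3 ε)).congr_fun (fun ξ hξ => (e ε hε ξ hξ).symm)
    (hms ε), ?_⟩
  have t1 := (tendsto_truncated_cauchy hC (fun t ht => thetaExt_of_notMem h hs ht) hy).neg
  have t2 := tendsto_setIntegral_sdiff_Ioo i2 y
  have t3 := t1.add t2
  have e3 : -truncHilbert p.thetaExt (p.y₂ - p.y₁ + 1) y + ∫ ξ in Icc p.y₁ p.y₂, p.thetaExt ξ *
      (1 / ξ - p.m₂ * y / (p.m₂ * ξ * y - p.lam₂)) = p.pvValue y := by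
    unfold pvValue regularPartReal
    rw [intervalIntegral.integral_of_le h12.le, MeasureTheory.integral_Icc_eq_integral_Ioc]
    ring
  rw [e3] at t3
  refine t3.congr' ?_
  filter_upwards [self_mem_nhdsWithin] with ε hε
  rw [MeasureTheory.setIntegral_congr_fun (hms ε) (e ε hε), ← MeasureTheory.integral_neg,
    ← MeasureTheory.integral_add (i1 ε hε) (i3 ε)]

theorem tendsto_phi₁_lowerPoint (h : p.Pos) (hs : p.Stable) {y : ℝ}
    (hy : y ∈ Icc p.y₁ p.y₂) :
    Tendsto p.phi₁ (𝓝[p.Dint] (p.lowerPoint y))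
      (𝓝 (Complex.exp (-Complex.I * p.Theta₁ y + ((1 / Real.pi * p.pvValue y : ℝ) : ℂ)))) := by
  have h0 := pos_of_mem h hs hy
  have hyc : (y : ℂ) ≠ 0 := by exact_mod_cast h0.ne'
  set x₀ := p.lowerPoint y with hx₀def
  have hn : ‖x₀‖ = p.r₁ := norm_lowerPoint h hs hy
  have hx₀ : x₀ ≠ 0 := ne_zero_of_norm h hn
  have hq := lowerPoint_quadratic h hs hy
  obtain ⟨C, hC⟩ := exists_sqrt_modulus_thetaExt h hs
  have hsupp : ∀ t, t ∉ Ioo p.y₁ p.y₂ → p.thetaExt t = 0 := fun t ht =>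
    thetaExt_of_notMem h hs ht
  have cY := continuousAt_Y₀ h hs hx₀ hy hq
  have hY : Tendsto p.Y₀ (𝓝[p.Dint] x₀) (𝓝 (y : ℂ)) := by
    have := cY.tendsto.mono_left (nhdsWithin_le_nhds (s := p.Dint))
    rwa [Y₀_eq h hs hx₀ hy hq] at this
  have hB : ContinuousAt p.swap.B x₀ := by unfold B; fun_prop
  have hsm : ContinuousAt (fun η : ℂ => p.m₂ * (η.re ^ 2 + η.im ^ 2)) (y : ℂ) :=
    Continuous.continuousAt (by fun_prop)
  have hreg : ContinuousAt (fun η : ℂ => p.m₂ * p.y₂ * ‖η‖) (y : ℂ) :=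
    Continuous.continuousAt (by fun_prop)
  have ev : ∀ᶠ x in 𝓝[p.Dint] x₀, ‖x‖ < p.r₁ ∧ x ≠ 0 ∧ p.Y₀ x ≠ 0 ∧ p.K x (p.Y₀ x) = 0 ∧
      p.m₂ * ((p.Y₀ x).re ^ 2 + (p.Y₀ x).im ^ 2) < p.lam₂ ∧
      p.m₂ * p.y₂ * ‖p.Y₀ x‖ < p.lam₂ := by
    have v1 := hsm.eventually_lt_const (u := p.lam₂) (by
      have := lam₂_sub_pos h hs hy
      simp
      linarith)
    have v2 := hreg.eventually_lt_const (u := p.lam₂) (regular_of_mem h hs hy)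
    filter_upwards [self_mem_nhdsWithin, nhdsWithin_le_nhds (eventually_ne_nhds hx₀),
      hY.eventually (eventually_ne_nhds hyc), hY.eventually v1, hY.eventually v2,
      nhdsWithin_le_nhds (hB.eventually_ne (swap_B_ne_zero h hx₀ h0 hq))]
      with x a1 a2 a3 a4 a5 a6
    exact ⟨mem_Dint.1 a1, a2, a3, K_Y₀ h a2 a6, a4, a5⟩
  have hlim : Tendsto (fun x => ∫ ξ in p.y₁..p.y₂, (p.thetaExt ξ : ℂ) / (ξ - p.Y₀ x))
      (𝓝[p.Dint] x₀) (𝓝 (truncHilbert p.thetaExt (p.y₂ - p.y₁ + 1) y +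
        p.thetaExt y * (Real.pi * Complex.I))) := by
    -- Inside the cut `Im x₀ < 0`, which forces `Y₀ x` into the upper half-plane. At an endpoint
    -- `x₀` is real and `Y₀ x` may lie on either side, but the density vanishes and it suffices that
    -- `Y₀ x` avoids the cut.
    rcases (kernelTrace_sq_le h hs hy).lt_or_eq with hlt | heq
    · refine (tendsto_cauchy_integral_upper hC hsupp hy).comp
        (tendsto_nhdsWithin_of_tendsto_nhds_of_eventually_within _ hY ?_)
      have him : x₀.im < 0 := by
        have e := lowerPoint_im h y
        have := Real.sqrt_pos.2 (sub_pos.2 hlt)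
        have hm := h.m₁
        by_contra hc
        have : 0 ≤ 2 * p.m₁ * x₀.im := mul_nonneg (by positivity) (not_lt.1 hc)
        linarith
      filter_upwards [ev, nhdsWithin_le_nhds
        (Complex.continuous_im.continuousAt.eventually_lt_const him)] with x hx hxi
      exact im_pos_of_K_eq_zero h hx.2.1 hx.2.2.1 hx.2.2.2.1 hx.1 hx.2.2.2.2.1 hxi
    · have hz : p.thetaExt y = 0 := by
        rw [thetaExt_of_mem hy]
        apply Theta₁_eq_zero_of_Delta
        have := neg_Delta₁real_eq p h0.ne'
        rw [heq, sub_self, mul_zero] at this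
        linarith
      rw [hz, Complex.ofReal_zero, zero_mul, add_zero]
      refine (tendsto_cauchy_integral_of_eq_zero hC hsupp hy hz).comp
        (tendsto_nhdsWithin_of_tendsto_nhds_of_eventually_within _ hY ?_)
      filter_upwards [ev] with x hx him hmem
      have e : p.Y₀ x = ((p.Y₀ x).re : ℂ) := Complex.ext (by simp) (by simpa using him)
      have hK := hx.2.2.2.1
      rw [e] at hK
      exact K_ne_zero h hs hx.1.ne (Ioo_subset_Icc_self hmem) hK
  have hR : Tendsto (fun x => p.regularPart (p.Y₀ x)) (𝓝[p.Dint] x₀)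
      (𝓝 (p.regularPartReal y : ℂ)) := by
    rw [← regularPart_ofReal]
    exact (continuousAt_regularPart h hs hy).tendsto.comp hY
  have hfin := (Complex.continuous_exp.tendsto _).comp
    ((hlim.neg.add hR).const_mul (1 / Real.pi : ℂ))
  have e : (1 / Real.pi : ℂ) * (-(truncHilbert p.thetaExt (p.y₂ - p.y₁ + 1) y +
      p.thetaExt y * (Real.pi * Complex.I)) + p.regularPartReal y) =
      -Complex.I * p.Theta₁ y + ((1 / Real.pi * p.pvValue y : ℝ) : ℂ) := by
    rw [thetaExt_of_mem hy]
    unfold pvValue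
    have : (Real.pi : ℂ) ≠ 0 := by exact_mod_cast Real.pi_ne_zero
    push_cast
    field_simp
    ring
  rw [e] at hfin
  refine hfin.congr' ?_
  filter_upwards [ev] with x hx
  exact (phi₁_eq_exp h hs hx.1.ne hx.2.1 hx.2.2.1 hx.2.2.2.1 hx.2.2.2.2.2).symm

theorem tendsto_phi₁_conj_lowerPoint (h : p.Pos) (hs : p.Stable) {y : ℝ}
    (hy : y ∈ Icc p.y₁ p.y₂) :
    Tendsto p.phi₁ (𝓝[p.Dint] ((starRingEnd ℂ) (p.lowerPoint y)))
      (𝓝 (Complex.exp (Complex.I * p.Theta₁ y + ((1 / Real.pi * p.pvValue y : ℝ) : ℂ)))) := by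
  have := tendsto_phi₁_Dint_conj (tendsto_phi₁_lowerPoint h hs hy)
  rw [← Complex.exp_conj, map_add, map_mul, map_neg, Complex.conj_I, Complex.conj_ofReal,
    Complex.conj_ofReal, neg_neg] at this
  exact this

/-- The boundary values of `φ₁` on the circle, and their jump. -/
theorem exists_phi₁_limits (h : p.Pos) (hs : p.Stable) {x : ℂ} (hx : ‖x‖ = p.r₁) :
    ∃ φi φe : ℂ, φi ≠ 0 ∧ φe ≠ 0 ∧ Tendsto p.phi₁ (𝓝[p.Dint] x) (𝓝 φi) ∧
      Tendsto p.phi₁ (𝓝[p.Dext] x) (𝓝 φe) ∧ φi = p.alpha₁ x * φe := by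
  obtain ⟨y, hy, rfl | rfl⟩ := exists_lowerPoint h hs hx
  · refine ⟨_, _, Complex.exp_ne_zero _, Complex.exp_ne_zero _, tendsto_phi₁_lowerPoint h hs hy,
      tendsto_phi₁_Dext h hx (tendsto_phi₁_conj_lowerPoint h hs hy), ?_⟩
    rw [Complex.exp_add, Complex.exp_add, alpha₁_lowerPoint h hs hy, mul_assoc]
  · refine ⟨_, _, Complex.exp_ne_zero _, Complex.exp_ne_zero _,
      tendsto_phi₁_conj_lowerPoint h hs hy,
      tendsto_phi₁_Dext h hx (by
        rw [Complex.conj_conj]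
        exact tendsto_phi₁_lowerPoint h hs hy), ?_⟩
    rw [Complex.exp_add, Complex.exp_add, alpha₁_conj_lowerPoint h hs hy, mul_assoc]

theorem isRHSolution_phi₁ (h : p.Pos) (hs : p.Stable) : p.IsRHSolution p.phi₁ where
  analytic_int := (analyticOnNhd_phi₁ h hs).mono fun _ hx => (mem_Dint.1 hx).ne
  analytic_ext := (analyticOnNhd_phi₁ h hs).mono fun _ hx => (mem_Dext.1 hx).ne'
  jump := by
    intro x hx
    obtain ⟨φi, φe, -, -, h1, h2, h3⟩ := exists_phi₁_limits h hs (mem_sphere_zero_iff_norm.1 hx)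
    exact ⟨φi, φe, h1, h2, h3⟩
  at_infinity := tendsto_phi₁_cobounded h hs

end RWParams

/-! ### Removal of the circle. -/

/-- A continuous function on the plane which is holomorphic off a circle centred at the origin and
tends to zero at infinity vanishes inside the circle. -/
theorem eq_zero_of_differentiable_off_circle {r : ℝ} (hr : 0 < r) {F : ℂ → ℂ}
    (hF : Continuous F) (hd : ∀ z, ‖z‖ ≠ r → DifferentiableAt ℂ F z)
    (hinf : Tendsto F (Bornology.cobounded ℂ) (𝓝 0)) {x : ℂ} (hx : ‖x‖ < r) : F x = 0 := by
  have hxb : x ∈ Metric.ball (0 : ℂ) r := mem_ball_zero_iff.2 hx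
  have hcl : DiffContOnCl ℂ F (Metric.ball 0 r) :=
    ⟨fun z hz => (hd z (mem_ball_zero_iff.1 hz).ne).differentiableWithinAt, hF.continuousOn⟩
  have h1 := hcl.two_pi_i_inv_smul_circleIntegral_sub_inv_smul hxb
  -- Continuity of `F` on the circle lets the contour of Cauchy's formula move outward from radius
  -- `r`.
  have hann : ∀ R, r ≤ R → (∮ z in C(0, R), (z - x)⁻¹ • F z) = ∮ z in C(0, r), (z - x)⁻¹ • F z := by
    intro R hR
    have hne : ∀ z : ℂ, r ≤ ‖z‖ → z - x ≠ 0 := by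
      intro z hz h0
      rw [sub_eq_zero.1 h0] at hz
      linarith
    apply Complex.circleIntegral_eq_of_differentiable_on_annulus_off_countable hr hR
      countable_empty
    · have hc : ContinuousOn (fun z : ℂ => z - x) (Metric.closedBall 0 R \ Metric.ball 0 r) := by
        fun_prop
      exact (hc.inv₀ fun z hz => hne z (by simpa using hz.2)).smul hF.continuousOn
    · intro z hz
      have hz' : r < ‖z‖ := by simpa using hz.1.2
      exact ((differentiableAt_id.sub_const x).inv (hne z hz'.le)).smul (hd z hz'.ne')
  rw [← norm_eq_zero]
  apply le_antisymm _ (norm_nonneg _)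
  apply le_of_forall_pos_le_add
  intro ε hε
  have hev : ∀ᶠ z in Bornology.cobounded ℂ, ‖F z‖ ≤ ε / 2 := by
    have := hinf.norm
    rw [norm_zero] at this
    exact (this.eventually_lt_const (half_pos hε)).mono fun _ h => h.le
  obtain ⟨M, hM⟩ := (hasBasis_cobounded_norm (E := ℂ)).eventually_iff.1 hev
  -- `R ≥ 2r` gives `|z - x| ≥ R/2` on the contour, so the Cauchy mean is at most `R · (R/2)⁻¹ · ε/2
  -- = ε`.
  set R := max M (2 * r) with hRdef
  have hR2 : 2 * r ≤ R := le_max_right _ _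
  have hR0 : 0 < R := by linarith
  rw [← hann R (by linarith)] at h1
  have hb := circleIntegral.norm_two_pi_i_inv_smul_integral_le_of_norm_le_const
    (f := fun z => (z - x)⁻¹ • F z) (c := 0) (R := R) (C := (R / 2)⁻¹ * (ε / 2)) hR0.le (by
      intro z hz
      have hz' : ‖z‖ = R := by simpa using hz
      rw [norm_smul, norm_inv]
      have h2 : R / 2 ≤ ‖z - x‖ := by
        have := norm_sub_norm_le z x
        linarith
      have h3 : ‖F z‖ ≤ ε / 2 := hM.2 (by
        show M ≤ ‖z‖
        rw [hz']
        exact le_max_left _ _)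
      gcongr)
  rw [h1] at hb
  refine hb.trans_eq ?_
  field_simp
  ring

/-- Removal of a circle: a function holomorphic off a circle, whose interior and exterior limits
on the circle agree and which tends to one at infinity, is one inside the circle. -/
theorem eq_one_of_matching_limits {r : ℝ} (hr : 0 < r) {g : ℂ → ℂ}
    (hd : DifferentiableOn ℂ g {x | ‖x‖ ≠ r})
    (hlim : ∀ x, ‖x‖ = r → ∃ l, Tendsto g (𝓝[Metric.ball 0 r] x) (𝓝 l) ∧
      Tendsto g (𝓝[(Metric.closedBall 0 r)ᶜ] x) (𝓝 l))
    (hinf : Tendsto g (Bornology.cobounded ℂ) (𝓝 1)) {x : ℂ} (hx : ‖x‖ < r) : g x = 1 := by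
  set A : Set ℂ := {x | ‖x‖ ≠ r} with hA
  have hAo : IsOpen A := isOpen_ne_fun continuous_norm continuous_const
  have hAeq : A = Metric.ball 0 r ∪ (Metric.closedBall 0 r)ᶜ := by
    ext z
    rw [mem_union, mem_ball_zero_iff, mem_compl_iff, mem_closedBall_zero_iff, not_le]
    exact ne_iff_lt_or_gt
  have hAd : Dense A := by
    have : A = (Metric.sphere (0 : ℂ) r)ᶜ := by ext z; simp [hA]
    rw [this, ← interior_eq_empty_iff_dense_compl]
    exact interior_sphere _ hr.ne'
  have hlim' : ∀ z, ∃ l, Tendsto g (𝓝[A] z) (𝓝 l) := by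
    intro z
    by_cases hz : ‖z‖ = r
    · obtain ⟨l, h1, h2⟩ := hlim z hz
      exact ⟨l, by rw [hAeq, nhdsWithin_union]; exact h1.sup h2⟩
    · exact ⟨g z, (hd z hz).continuousWithinAt⟩
  -- The values of `g` on the circle are arbitrary and are replaced by the common limits.
  have hFc : Continuous (extendFrom A g) := continuous_extendFrom hAd hlim'
  have hFg : ∀ z ∈ A, extendFrom A g z = g z := fun z hz =>
    extendFrom_eq (hAd z) (hd z hz).continuousWithinAt
  have hinf' : Tendsto (fun z => extendFrom A g z - 1) (Bornology.cobounded ℂ) (𝓝 0) := by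
    have h1 : Tendsto (fun z => g z - 1) (Bornology.cobounded ℂ) (𝓝 0) := by
      simpa using hinf.sub_const 1
    refine h1.congr' ?_
    filter_upwards [(hasBasis_cobounded_norm (E := ℂ)).mem_of_mem (i := r + 1) trivial] with z hz
    have hz : r + 1 ≤ ‖z‖ := hz
    rw [hFg z (show ‖z‖ ≠ r by linarith)]
  have key := eq_zero_of_differentiable_off_circle hr (hFc.sub continuous_const) (fun z hz => by
    have h1 : DifferentiableAt ℂ g z := hd.differentiableAt (hAo.mem_nhds hz)
    refine (h1.sub_const 1).congr_of_eventuallyEq ?_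
    filter_upwards [hAo.mem_nhds hz] with w hw
    simp only [Pi.sub_apply, hFg w hw]) hinf' hx
  simp only [Pi.sub_apply] at key
  rw [← hFg x hx.ne]
  exact sub_eq_zero.1 key

/-! ### Uniqueness in the disc. -/

namespace RWParams

variable {p : RWParams}

/-- In `ψ / φ₁` the coefficient `α₁` cancels between the two sides of the circle. This needs the
limits of `φ₁` to be nonzero, which holds because they are exponentials, and then `α₁ ≠ 0` follows
from the jump of `φ₁` itself. -/
theorem IsRHSolution.eqOn_phi₁ (h : p.Pos) (hs : p.Stable) {ψ : ℂ → ℂ} (hψ : p.IsRHSolution ψ) :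
    EqOn ψ p.phi₁ p.Dint := by
  intro x hx
  have hd : DifferentiableOn ℂ (fun z => ψ z / p.phi₁ z) {z | ‖z‖ ≠ p.r₁} := by
    refine DifferentiableOn.div (fun z hz => ?_) (differentiableOn_phi₁ h hs)
      fun z _ => p.phi₁_ne_zero z
    apply DifferentiableAt.differentiableWithinAt
    rcases lt_or_gt_of_ne (show ‖z‖ ≠ p.r₁ from hz) with h1 | h1
    · exact (hψ.analytic_int z (mem_Dint.2 h1)).differentiableAt
    · exact (hψ.analytic_ext z (mem_Dext.2 h1)).differentiableAt
  have key := eq_one_of_matching_limits h.r₁_pos hd (fun z hz => by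
    obtain ⟨ψi, ψe, a1, a2, a3⟩ := hψ.jump z (mem_sphere_zero_iff_norm.2 hz)
    obtain ⟨φi, φe, hi, he, b1, b2, b3⟩ := exists_phi₁_limits h hs hz
    have hα : p.alpha₁ z ≠ 0 := by
      intro h0
      rw [h0, zero_mul] at b3
      exact hi b3
    have e : ψi / φi = ψe / φe := by
      rw [a3, b3, mul_div_mul_left _ _ hα]
    refine ⟨ψi / φi, a1.div b1 hi, ?_⟩
    rw [e]
    exact a2.div b2 he) (by
      have := hψ.at_infinity.div (tendsto_phi₁_cobounded h hs) one_ne_zero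
      rwa [div_one] at this) (mem_Dint.1 hx)
  exact (div_eq_one_iff_eq (p.phi₁_ne_zero x)).1 key

end RWParams

theorem mainTheorem6 (p : RWParams) (hpos : p.Pos) (hstable : p.Stable) :
    (p.IsRHSolution p.phi₁ ∧
      ∀ ψ : ℂ → ℂ, p.IsRHSolution ψ → EqOn ψ p.phi₁ p.Dint) ∧
    ∀ y ∈ Icc p.y₁ p.y₂, ∃ (x : ℂ) (I : ℝ),
      Tendsto (fun ε : ℝ => p.X₀ (y + ε * Complex.I)) (𝓝[>] 0) (𝓝 x) ∧
      x ∈ Metric.sphere (0 : ℂ) p.r₁ ∧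
      RWParams.HasCauchyPV (p.PhiIntegrand y) p.y₁ p.y₂ y I ∧
      Tendsto p.phi₁ (𝓝[p.Dint] x)
        (𝓝 (Complex.exp (-Complex.I * p.Theta₁ y + ((1 / Real.pi * I : ℝ) : ℂ)))) :=
  ⟨⟨RWParams.isRHSolution_phi₁ hpos hstable,
    fun _ hψ => RWParams.IsRHSolution.eqOn_phi₁ hpos hstable hψ⟩,
    fun y hy => ⟨p.lowerPoint y, p.pvValue y, RWParams.tendsto_X₀ hpos hstable hy,
      mem_sphere_zero_iff_norm.2 (RWParams.norm_lowerPoint hpos hstable hy),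
      RWParams.hasCauchyPV_PhiIntegrand hpos hstable hy,
      RWParams.tendsto_phi₁_lowerPoint hpos hstable hy⟩⟩
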